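/- Fix $k>0$, let $\rho(x)=x^2/2$ for $|x|\le k$ and $\rho(x)=k|x|-k^2/2$ for $|x|>k$ be the Huber loss, and let $\psi(x)=\rho'(x)=\max\{\min\{x,k\},-k\}$. Let $(\mathbf x,\epsilon),(\mathbf x_1,\epsilon_1),(\mathbf x_2,\epsilon_2),\dots$ be i.i.d. with values in $\mathbb R^p\times\mathbb R$, where $\mathbf x$ has finite second moments, mean $\mu_x^*$ and positive definite covariance matrix $\Sigma_x^*$, and suppose $$y_i=\mu^*+\mathbf x_i^{T}\beta^*+\epsilon_i,\qquad \mathbb E[\psi(\epsilon)\mid\mathbf x]=0 .$$ Let $\mathcal E$ be the $\Sigma_x^*$-envelope of $\mathrm{span}(\beta^*)$, i.e. the intersection of all subspaces $R\ni\beta^*$ of $\mathbb R^p$ with $\Sigma_x^*=\mathbf P_R\Sigma_x^*\mathbf P_R+\mathbf Q_R\Sigma_x^*\mathbf Q_R$, where $\mathbf P_R$ and $\mathbf Q_R=\mathbf I-\mathbf P_R$ are the orthogonal projections onto $R$ and $R^\perp$. Let $u=\dim\mathcal E$, let $\Gamma\in\mathbb R^{p\times u}$ and $\Gamma_0\in\mathbb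 R^{p\times(p-u)}$ have orthonormal columns that form bases of $\mathcal E$ and $\mathcal E^\perp$, and write $\beta^*=\Gamma\eta$ and $\Sigma_x^*=\Gamma\Omega\Gamma^T+\Gamma_0\Omega_0\Gamma_0^T$ with $\eta\in\mathbb R^u$ and positive semidefinite $\Omega,\Omega_0$. Assume further that $\epsilon$ is independent of $\mathbf x$, that $\mathbb P(|\epsilon|=k)=0$ (so that $\psi'(\epsilon)$ is almost surely defined), and that $\mathbb E[\psi'(\epsilon)]\ne0$. For each $n$ let $(\hat\mu,\hat\eta)$ be a minimizer of $\sum_{i=1}^n\rho(y_i-\mu-\eta^T\Gamma^T\mathbf x_i)$ over $\mu\in\mathbb R,\ \eta\in\mathbb R^u$ (Huber regression on $\Gamma^T\mathbf x$ with $\Gamma$ known), and let $\hat\beta_{eh}^*=\Gamma\hat\eta$. Then $\Omega$ is positive definite and $$\sqrt n(\hat\beta_{eh}^*-\beta^*)\overset{d}{\to}N\left(0,\ \frac{\mathbb E[\psi^2(\epsilon)]}{(\mathbb E[\psi'(\epsilon)])^2}\,\Gamma\Omega^{-1}\Gamma^T\right).$$ Moreover, if for each $n$ $(\hat\mu_h,\hat\beta_h)$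 is a minimizer of $\sum_{i=1}^n\rho(y_i-\mu-\mathbf x_i^T\beta)$ over $\mu\in\mathbb R,\ \beta\in\mathbb R^p$ (usual Huber regression), then $$\sqrt n(\hat\beta_h-\beta^*)\overset{d}{\to}N\left(0,\ \frac{\mathbb E[\psi^2(\epsilon)]}{(\mathbb E[\psi'(\epsilon)])^2}\,\Sigma_x^{*-1}\right),$$ and the enveloped estimator has the smaller asymptotic covariance: $$\frac{\mathbb E[\psi^2(\epsilon)]}{(\mathbb E[\psi'(\epsilon)])^2}\,\Gamma\Omega^{-1}\Gamma^T\ \preceq\ \frac{\mathbb E[\psi^2(\epsilon)]}{(\mathbb E[\psi'(\epsilon)])^2}\,\Sigma_x^{*-1}$$ in the positive semidefinite order, and the two matrices are different whenever $u<p$ and $\mathbb E[\psi^2(\epsilon)]\neq0$. -/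

import Mathlib

open MeasureTheory ProbabilityTheory Filter
open scoped Matrix

noncomputable section

/-- The Huber loss with tuning parameter `k`. -/
def huberLoss (k x : ℝ) : ℝ :=
  if |x| ≤ k then x ^ 2 / 2 else k * |x| - k ^ 2 / 2

/-- The influence function `ψ = ρ'` of the Huber loss, i.e. `x` truncated to `[-k, k]`. -/
def huberPsi (k x : ℝ) : ℝ :=
  max (min x k) (-k)

/-- The objective of Huber regression of `y` on predictors `z ∈ ℝᵈ`, from the first `n`
observations, at intercept `m` and slope `b`. -/
def huberObjective {d : ℕ} (k : ℝ) (n : ℕ) (y : ℕ → ℝ) (z : ℕ → EuclideanSpace ℝ (Fin d))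
    (m : ℝ) (b : EuclideanSpace ℝ (Fin d)) : ℝ :=
  ∑ i ∈ Finset.range n, huberLoss k (y i - m - inner ℝ (z i) b)

/-- `(m, b)` is a solution of the Huber regression of `y` on `z` from the first `n`
observations. -/
def IsHuberFit {d : ℕ} (k : ℝ) (n : ℕ) (y : ℕ → ℝ) (z : ℕ → EuclideanSpace ℝ (Fin d))
    (m : ℝ) (b : EuclideanSpace ℝ (Fin d)) : Prop :=
  ∀ (m' : ℝ) (b' : EuclideanSpace ℝ (Fin d)),
    huberObjective k n y z m b ≤ huberObjective k n y z m' b'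

/-- A matrix applied to a Euclidean vector. -/
def matApply {a b : ℕ} (M : Matrix (Fin a) (Fin b) ℝ) (v : EuclideanSpace ℝ (Fin b)) :
    EuclideanSpace ℝ (Fin a) :=
  WithLp.toLp 2 (M *ᵥ v.ofLp)

/-- The subspace spanned by the columns of a matrix. -/
def colSpan {a b : ℕ} (M : Matrix (Fin a) (Fin b) ℝ) : Submodule ℝ (EuclideanSpace ℝ (Fin a)) :=
  Submodule.span ℝ (Set.range fun j : Fin b => WithLp.toLp 2 (fun i : Fin a => M i j))

/-- `R` is a reducing subspace of `M`: `M = P_R M P_R + Q_R M Q_R`, where `P_R` and `Q_R` are the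
orthogonal projections onto `R` and its orthogonal complement. -/
def IsReducing {p : ℕ} (M : Matrix (Fin p) (Fin p) ℝ)
    (R : Submodule ℝ (EuclideanSpace ℝ (Fin p))) : Prop :=
  Matrix.toEuclideanCLM (𝕜 := ℝ) M =
    R.starProjection * Matrix.toEuclideanCLM (𝕜 := ℝ) M * R.starProjection +
      Rᗮ.starProjection * Matrix.toEuclideanCLM (𝕜 := ℝ) M * Rᗮ.starProjection

/-- The `M`-envelope of `span β`: the intersection of all reducing subspaces of `M` that
contain `β`. -/
def predictorEnvelope {p : ℕ} (M : Matrix (Fin p) (Fin p) ℝ) (β : EuclideanSpace ℝ (Fin p)) :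
    Submodule ℝ (EuclideanSpace ℝ (Fin p)) :=
  sInf {R | IsReducing M R ∧ β ∈ R}

/-- The enveloped Huber regression model for the observations `(y i, X i)` with errors `ε i`.
`Sx` is the covariance matrix of the predictors; the generic copy `(x, ε)` is `(X 0, ε 0)`. -/
structure EnvelopedHuberModel {S : Type*} [MeasurableSpace S] (P : Measure S) {p u : ℕ} (k : ℝ)
    (X : ℕ → S → EuclideanSpace ℝ (Fin p)) (ε y : ℕ → S → ℝ)
    (μ : ℝ) (β μx : EuclideanSpace ℝ (Fin p)) (Sx : Matrix (Fin p) (Fin p) ℝ)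
    (Γ : Matrix (Fin p) (Fin u) ℝ) (Γ₀ : Matrix (Fin p) (Fin (p - u)) ℝ)
    (η : EuclideanSpace ℝ (Fin u)) (Ω : Matrix (Fin u) (Fin u) ℝ)
    (Ω₀ : Matrix (Fin (p - u)) (Fin (p - u)) ℝ) : Prop where
  measurable_X : ∀ i, Measurable (X i)
  measurable_ε : ∀ i, Measurable (ε i)
  response : ∀ i ω, y i ω = μ + inner ℝ (X i ω) β + ε i ω
  indep : iIndepFun (fun i ω => (X i ω, ε i ω)) P
  ident : ∀ i, IdentDistrib (fun ω => (X i ω, ε i ω)) (fun ω => (X 0 ω, ε 0 ω)) P P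
  -- `x ∼ (μx, Sx)` with `Sx` positive definite
  memLp_two : MemLp (X 0) 2 P
  mean_eq : ∫ ω, X 0 ω ∂P = μx
  cov_eq : ∀ a b, cov[fun ω => X 0 ω a, fun ω => X 0 ω b; P] = Sx a b
  posDef_cov : Sx.PosDef
  -- `E[ψ(ε) | x] = 0`
  condExp_psi : P[fun ω => huberPsi k (ε 0 ω) | MeasurableSpace.comap (X 0) inferInstance] =ᵐ[P] 0
  -- semi-orthogonal bases of the envelope and of its orthogonal complement
  semiorthogonal : Γᵀ * Γ = 1
  semiorthogonal₀ : Γ₀ᵀ * Γ₀ = 1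
  span_eq : colSpan Γ = predictorEnvelope Sx β
  span_eq₀ : colSpan Γ₀ = (predictorEnvelope Sx β)ᗮ
  -- envelope parametrization
  posSemidef_Ω : Ω.PosSemidef
  posSemidef_Ω₀ : Ω₀.PosSemidef
  slope_eq : β = matApply Γ η
  cov_decomp : Sx = Γ * Ω * Γᵀ + Γ₀ * Ω₀ * Γ₀ᵀ

/-- The Huber factor `E[ψ(ε)²] / (E[ψ'(ε)])²`. -/
def huberFactor {S : Type*} [MeasurableSpace S] (P : Measure S) (k : ℝ) (ε : S → ℝ) : ℝ :=
  (∫ ω, huberPsi k (ε ω) ^ 2 ∂P) / (∫ ω, deriv (huberPsi k) (ε ω) ∂P) ^ 2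

/-- `√n (b̂ₙ - β)` converges in distribution to the centred normal law with covariance `V`. -/
def SqrtNAsympNormal {S : Type*} [MeasurableSpace S] (P : Measure S) [IsProbabilityMeasure P]
    {p : ℕ} (bhat : ℕ → S → EuclideanSpace ℝ (Fin p)) (β : EuclideanSpace ℝ (Fin p))
    (V : Matrix (Fin p) (Fin p) ℝ) : Prop :=
  TendstoInDistribution (fun (n : ℕ) ω => Real.sqrt n • (bhat n ω - β)) atTop id
    (fun _ => P) (multivariateGaussian 0 V)

end

noncomputable section

open scoped Topology InnerProductSpace

/-! ### The Huber loss -/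


/-! Both limit laws are instances of one result on Huber regression with random design,
`sqrtNAsympNormal_huberFit`. With `v = (1, z - m)`, the rescaled deviation `t` of a fit from the
truth minimizes the convex function `localHuber`. Its linear part at the origin is `-⟪U, t⟫`, where
`U` is the normalized score `huberScore`. What remains is a sum of terms `huberRemainder k e h`,
each exactly `h ^ 2 / 2` or `0` unless `|e|` lies within `|h|` of `k` (`abs_huberRemainder_sub_le`).

The strong law identifies the quadratic part as `V = q E[v vᵀ]` with `q = P(|ε| < k) = E[ψ'(ε)]`,
and the absence of atoms at `±k` makes the exceptional terms negligible. So almost surely the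
objective is uniformly close to `⟪t, V t⟫ / 2 - ⟪U, t⟫` on balls
(`eventually_localHuber_quadratic`), and convexity places its minimizers near `V⁻¹ U` as long as `U`
stays bounded (`norm_argmin_sub_le`). The central limit theorem makes `U` tight, so the
linearization error vanishes in measure (`tendstoInMeasure_zero_of_isTight`) and Slutsky's theorem
transfers the normal limit. By independence the score has covariance `E[ψ²] E[v vᵀ]`, which
collapses the sandwich `V⁻¹ Cov V⁻¹` to the Huber factor times an inverse covariance.

For the envelope, `Γᵀ x` is a valid design with slope `η` and covariance `Ω`. Block inversion gives
`Sx⁻¹ = Γ Ω⁻¹ Γᵀ + Γ₀ Ω₀⁻¹ Γ₀ᵀ`; the second summand is the efficiency gain, positive semidefinite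
and nonzero when `u < p`. -/

theorem abs_huberPsi_le {k : ℝ} (hk : 0 ≤ k) (x : ℝ) : |huberPsi k x| ≤ k := by
  unfold huberPsi
  rw [abs_le]
  exact ⟨le_max_right _ _, max_le (min_le_right _ _) (by linarith)⟩

theorem huberPsi_of_abs_le {k x : ℝ} (h : |x| ≤ k) : huberPsi k x = x := by
  rw [abs_le] at h
  simp [huberPsi, h.1, h.2]

theorem huberPsi_of_lt {k x : ℝ} (hk : 0 ≤ k) (h : k < x) : huberPsi k x = k := by
  rw [huberPsi, min_eq_right h.le, max_eq_left (by linarith)]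

theorem huberPsi_of_lt_neg {k x : ℝ} (h : x < -k) : huberPsi k x = -k := by
  rw [huberPsi, max_eq_right ((min_le_left _ _).trans h.le)]

theorem continuous_huberPsi (k : ℝ) : Continuous (huberPsi k) := by
  unfold huberPsi
  fun_prop

theorem deriv_huberPsi {k x : ℝ} (hk : 0 < k) (h : |x| ≠ k) :
    deriv (huberPsi k) x = if |x| < k then 1 else 0 := by
  split_ifs with hx
  · have : huberPsi k =ᶠ[𝓝 x] id := by
      filter_upwards [(isOpen_lt continuous_abs continuous_const).mem_nhds hx] with y hy
      exact huberPsi_of_abs_le (le_of_lt hy)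
    rw [this.deriv_eq, deriv_id]
  · have hx' : k < |x| := lt_of_le_of_ne (not_lt.1 hx) h.symm
    rcases lt_abs.1 hx' with hx' | hx'
    · have : huberPsi k =ᶠ[𝓝 x] fun _ => k := by
        filter_upwards [lt_mem_nhds hx'] with y hy
        exact huberPsi_of_lt hk.le hy
      rw [this.deriv_eq, deriv_const]
    · have : huberPsi k =ᶠ[𝓝 x] fun _ => -k := by
        filter_upwards [gt_mem_nhds (lt_neg_of_lt_neg hx')] with y hy
        exact huberPsi_of_lt_neg hy
      rw [this.deriv_eq, deriv_const]

/-- The Huber loss is the convex conjugate of `a ↦ a² / 2` restricted to `[-k, k]`, attained at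
`a = ψ(x)`. -/
theorem huberLoss_eq {k : ℝ} (hk : 0 ≤ k) (x : ℝ) :
    huberLoss k x = huberPsi k x * x - huberPsi k x ^ 2 / 2 := by
  unfold huberLoss
  split_ifs with h
  · rw [huberPsi_of_abs_le h]; ring
  · rcases lt_abs.1 (not_le.1 h) with h' | h'
    · rw [huberPsi_of_lt hk h', abs_of_nonneg (by linarith)]
    · rw [huberPsi_of_lt_neg (by linarith), abs_of_nonpos (by linarith)]; ring

/-- Fenchel's inequality for the conjugate pair; `huberLoss_eq` is its equality case. -/
theorem mul_sub_sq_le_huberLoss {k a : ℝ} (ha : |a| ≤ k) (x : ℝ) :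
    a * x - a ^ 2 / 2 ≤ huberLoss k x := by
  unfold huberLoss
  split_ifs with h
  · nlinarith [sq_nonneg (a - x)]
  · have h1 : a * x ≤ |a| * |x| := by rw [← abs_mul]; exact le_abs_self _
    rw [← sq_abs a]
    nlinarith [abs_nonneg a, mul_nonneg (sub_nonneg.2 ha) (sub_nonneg.2 (not_le.1 h).le),
      sq_nonneg (k - |a|)]

/-- The Huber loss is the infimal convolution of `x ↦ x² / 2` and `k |x|`. -/
theorem huberLoss_le {k : ℝ} (hk : 0 ≤ k) (x s : ℝ) :
    huberLoss k x ≤ (x - s) ^ 2 / 2 + k * |s| := by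
  rw [huberLoss_eq hk]
  have h := abs_huberPsi_le hk x
  have h1 : huberPsi k x * s ≤ k * |s| :=
    (le_abs_self _).trans (by rw [abs_mul]; gcongr)
  nlinarith [sq_nonneg (huberPsi k x - (x - s))]

theorem huberLoss_subgradient {k : ℝ} (hk : 0 ≤ k) (x y : ℝ) :
    huberLoss k x + huberPsi k x * (y - x) ≤ huberLoss k y := by
  have := mul_sub_sq_le_huberLoss (abs_huberPsi_le hk x) y
  rw [huberLoss_eq hk x]
  linarith

/-- A function with a supporting line at every point is convex: average the two subgradient
inequalities based at the convex combination. -/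
theorem convexOn_huberLoss {k : ℝ} (hk : 0 ≤ k) : ConvexOn ℝ Set.univ (huberLoss k) := by
  refine ⟨convex_univ, fun x _ y _ a b ha hb hab => ?_⟩
  have h1 := mul_le_mul_of_nonneg_left (huberLoss_subgradient hk (a • x + b • y) x) ha
  have h2 := mul_le_mul_of_nonneg_left (huberLoss_subgradient hk (a • x + b • y) y) hb
  simp only [smul_eq_mul] at *
  obtain rfl : b = 1 - a := by linarith
  linarith

/-- The remainder of the first-order expansion of the Huber loss at `e`. -/
def huberRemainder (k e h : ℝ) : ℝ :=
  huberLoss k (e - h) - huberLoss k e + huberPsi k e * h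

theorem huberRemainder_nonneg {k : ℝ} (hk : 0 ≤ k) (e h : ℝ) : 0 ≤ huberRemainder k e h := by
  have := huberLoss_subgradient hk e (e - h)
  unfold huberRemainder
  linarith

/-- The infimal convolution bound is used with `s = e - ψ(e)`, the part of `e` cut off by
truncation; the quadratic term is then centred at `ψ(e)`. -/
theorem huberRemainder_le {k : ℝ} (hk : 0 ≤ k) (e h : ℝ) :
    huberRemainder k e h ≤ h ^ 2 / 2 := by
  have h1 := huberLoss_le hk (e - h) (e - huberPsi k e)
  have h2 : k * |e - huberPsi k e| = huberPsi k e * (e - huberPsi k e) := by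
    rcases le_or_gt |e| k with h | h
    · simp [huberPsi_of_abs_le h]
    · rcases lt_abs.1 h with h' | h'
      · rw [huberPsi_of_lt hk h', abs_of_nonneg (by linarith)]
      · rw [huberPsi_of_lt_neg (by linarith), abs_of_nonpos (by linarith)]; ring
  rw [h2] at h1
  unfold huberRemainder
  rw [huberLoss_eq hk e]
  nlinarith

/-- If `|e|` is farther than `|h|` from `k`, then `e` and `e - h` lie on the same quadratic or
linear piece of the loss and the expansion is exact. Otherwise both compared quantities lie in `[0,
h ^ 2 / 2]`. -/
theorem abs_huberRemainder_sub_le {k : ℝ} (hk : 0 ≤ k) (e h : ℝ) :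
    |huberRemainder k e h - (if |e| < k then 1 else 0) * (h ^ 2 / 2)| ≤
      (if |(|e| - k)| ≤ |h| then 1 else 0) * (h ^ 2 / 2) := by
  have h0 := huberRemainder_nonneg hk e h
  have h1 := huberRemainder_le hk e h
  split_ifs with he hh hh
  · rw [abs_le]; constructor <;> linarith
  · rw [not_le, lt_abs] at hh
    have hlt : |h| < k - |e| := by rcases hh with hh | hh <;> linarith [abs_nonneg h]
    have : |e - h| ≤ k := (abs_sub _ _).trans (by linarith)
    rw [huberRemainder, huberPsi_of_abs_le he.le, huberLoss, huberLoss, if_pos this, if_pos he.le]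
    apply le_of_eq
    rw [abs_eq_zero.2 (by ring), zero_mul]
  · rw [abs_le]; constructor <;> linarith
  · rw [not_le, lt_abs] at hh
    have hlt : |h| < |e| - k := by rcases hh with hh | hh <;> linarith [abs_nonneg h]
    have hh' := abs_lt.1 hlt
    have hek : k < |e| := by linarith [abs_nonneg h]
    rcases lt_abs.1 hek with h' | h'
    · rw [abs_of_pos (by linarith)] at hh'
      rw [huberRemainder, huberLoss_eq hk, huberLoss_eq hk, huberPsi_of_lt hk h',
        huberPsi_of_lt hk (by linarith)]
      apply le_of_eq
      rw [abs_eq_zero.2 (by ring), zero_mul]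
    · rw [abs_of_neg (by linarith)] at hh'
      rw [huberRemainder, huberLoss_eq hk, huberLoss_eq hk, huberPsi_of_lt_neg (by linarith),
        huberPsi_of_lt_neg (by linarith)]
      apply le_of_eq
      rw [abs_eq_zero.2 (by ring), zero_mul]

/-! ### Minimizers of approximately quadratic convex functions -/

section Argmin

variable {F : Type*} [NormedAddCommGroup F] [InnerProductSpace ℝ F]

/-- If a convex function `A` is uniformly within `δ` of `t ↦ ⟪t, V t⟫ / 2 - ⟪U, t⟫` on a ball, then
its minimizers are close to the minimizer `b` of that quadratic function. -/
theorem norm_argmin_sub_le {A : F → ℝ} (hA : ConvexOn ℝ Set.univ A) {V : F →L[ℝ] F} {c : ℝ}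
    (hV : ∀ s t, ⟪s, V t⟫_ℝ = ⟪t, V s⟫_ℝ) (hc : ∀ t, c * ‖t‖ ^ 2 ≤ ⟪t, V t⟫_ℝ)
    {b U that : F} (hb : V b = U) (hmin : ∀ t, A that ≤ A t) {R r δ : ℝ} (hr : 0 < r)
    (happ : ∀ t, ‖t‖ ≤ R → |A t + ⟪U, t⟫_ℝ - ⟪t, V t⟫_ℝ / 2| ≤ δ)
    (hR : ‖b‖ + r ≤ R) (hδ : 2 * δ < c * r ^ 2 / 2) : ‖that - b‖ ≤ r := by
  by_contra! hlt
  have hpos : 0 < ‖that - b‖ := hr.trans hlt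
  -- Pull the minimizer back along the segment to distance exactly `r` from `b`. Convexity keeps the
  -- value at most `A b`, whereas the quadratic exceeds its minimum there by at least `c * r ^ 2 /
  -- 2`.
  set a : ℝ := r / ‖that - b‖ with ha
  have ha0 : 0 ≤ a := by positivity
  have ha1 : a ≤ 1 := (div_le_one hpos).2 hlt.le
  set s : F := b + a • (that - b) with hs
  have hnorm : ‖s - b‖ = r := by
    rw [hs, add_sub_cancel_left, norm_smul, Real.norm_of_nonneg ha0, ha, div_mul_cancel₀ _ hpos.ne']
  have hAs : A s ≤ A b := by
    have h1 := hA.2 (Set.mem_univ that) (Set.mem_univ b) ha0 (sub_nonneg.2 ha1) (by ring)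
    have h2 : a • that + (1 - a) • b = s := by rw [hs]; module
    rw [h2, smul_eq_mul, smul_eq_mul] at h1
    nlinarith [hmin b]
  have hsR : ‖s‖ ≤ R := by
    have : s = b + (s - b) := by abel
    rw [this]
    exact (norm_add_le _ _).trans (by rw [hnorm]; exact hR)
  have h1 := abs_le.1 (happ s hsR)
  have h2 := abs_le.1 (happ b (by linarith))
  have h3 := hc (s - b)
  rw [hnorm] at h3
  have h4 : ⟪s - b, V (s - b)⟫_ℝ = ⟪s, V s⟫_ℝ - 2 * ⟪U, s⟫_ℝ + ⟪U, b⟫_ℝ := by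
    simp only [map_sub, inner_sub_left, inner_sub_right]
    rw [hV b s, hb, real_inner_comm U s, real_inner_comm U b]; ring
  have h5 : ⟪b, V b⟫_ℝ = ⟪U, b⟫_ℝ := by rw [hb, real_inner_comm]
  linarith [h1.1, h2.2]

end Argmin

/-! ### The local Huber objective -/

section LocalObjective

variable {F : Type*} [NormedAddCommGroup F] [InnerProductSpace ℝ F]

/-- The Huber objective as a function of the rescaled deviation `t` from the true parameter, up to
an additive constant. -/
def localHuber (k : ℝ) (e : ℕ → ℝ) (v : ℕ → F) (n : ℕ) (t : F) : ℝ :=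
  ∑ i ∈ Finset.range n, (huberLoss k (e i - (√n)⁻¹ * ⟪v i, t⟫_ℝ) - huberLoss k (e i))

/-- The normalized score `n^{-1/2} ∑ ψ(eᵢ) vᵢ`. -/
def huberScore (k : ℝ) (e : ℕ → ℝ) (v : ℕ → F) (n : ℕ) : F :=
  (√n)⁻¹ • ∑ i ∈ Finset.range n, huberPsi k (e i) • v i

theorem convexOn_localHuber {k : ℝ} (hk : 0 ≤ k) (e : ℕ → ℝ) (v : ℕ → F) (n : ℕ) :
    ConvexOn ℝ Set.univ (localHuber k e v n) := by
  refine ⟨convex_univ, fun x _ y _ a b ha hb hab => ?_⟩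
  simp only [localHuber, smul_eq_mul, Finset.mul_sum, ← Finset.sum_add_distrib]
  refine Finset.sum_le_sum fun i _ => ?_
  have h := (convexOn_huberLoss hk).2 (Set.mem_univ (e i - (√n)⁻¹ * ⟪v i, x⟫_ℝ))
    (Set.mem_univ (e i - (√n)⁻¹ * ⟪v i, y⟫_ℝ)) ha hb hab
  obtain rfl : b = 1 - a := by linarith
  have h2 : e i - (√n)⁻¹ * ⟪v i, a • x + (1 - a) • y⟫_ℝ =
      a • (e i - (√n)⁻¹ * ⟪v i, x⟫_ℝ) + (1 - a) • (e i - (√n)⁻¹ * ⟪v i, y⟫_ℝ) := by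
    simp only [inner_add_right, real_inner_smul_right, smul_eq_mul]
    ring
  rw [h2]
  simp only [smul_eq_mul] at *
  linarith

/-- Adding the score cancels the first-order terms, so the termwise remainder bounds apply. -/
theorem localHuber_add_score (k : ℝ) (e : ℕ → ℝ) (v : ℕ → F) (n : ℕ) (t : F) :
    localHuber k e v n t + ⟪huberScore k e v n, t⟫_ℝ =
      ∑ i ∈ Finset.range n, huberRemainder k (e i) ((√n)⁻¹ * ⟪v i, t⟫_ℝ) := by
  simp only [localHuber, huberScore, huberRemainder, real_inner_smul_left, sum_inner,
    Finset.mul_sum, ← Finset.sum_add_distrib]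
  refine Finset.sum_congr rfl fun i _ => ?_
  ring

/-- Uniform quadratic approximation of the local Huber objective, from the convergence of two kinds
of averages. -/
theorem eventually_localHuber_quadratic {k : ℝ} (hk : 0 ≤ k) {e : ℕ → ℝ} {v : ℕ → F}
    {V : F →L[ℝ] F} {ℓ : ℕ → ℝ}
    (hV : Tendsto (fun n : ℕ => (n : ℝ)⁻¹ • ∑ i ∈ Finset.range n,
      (if |e i| < k then (1 : ℝ) else 0) • InnerProductSpace.rankOne ℝ (v i) (v i)) atTop (𝓝 V))
    (hℓ : ∀ M : ℕ, Tendsto (fun n : ℕ => (n : ℝ)⁻¹ • ∑ i ∈ Finset.range n,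
      (if |(|e i| - k)| ≤ ‖v i‖ / (M + 1) then (1 : ℝ) else 0) * ‖v i‖ ^ 2) atTop (𝓝 (ℓ M)))
    (hℓ0 : Tendsto ℓ atTop (𝓝 0)) (R : ℝ) {δ : ℝ} (hδ : 0 < δ) :
    ∀ᶠ n : ℕ in atTop, ∀ t, ‖t‖ ≤ R →
      |localHuber k e v n t + ⟪huberScore k e v n, t⟫_ℝ - ⟪t, V t⟫_ℝ / 2| ≤ δ := by
  -- The remainder error and the operator error each cost `R ^ 2 / 2` times this tolerance, hence at
  -- most `δ` in total; the `+ 1` covers `R = 0`.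
  have hδ' : 0 < δ / (R ^ 2 + 1) := by positivity
  obtain ⟨M, hM⟩ := (hℓ0.eventually (gt_mem_nhds hδ')).exists
  have hsq : Tendsto (fun n : ℕ => √(n : ℝ)) atTop atTop :=
    Real.tendsto_sqrt_atTop.comp tendsto_natCast_atTop_atTop
  have hV' := (tendsto_iff_norm_sub_tendsto_zero.1 hV).eventually (gt_mem_nhds hδ')
  -- Once `√n ≥ R * (M + 1)`, the shrinking window `(√n)⁻¹ * |⟪v i, t⟫|` is contained in the window
  -- `‖v i‖ / (M + 1)`, which does not depend on `n` or `t`.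
  filter_upwards [(hℓ M).eventually (gt_mem_nhds hM), hV', hsq.eventually_ge_atTop (R * (M + 1)),
    eventually_gt_atTop 0] with n h1 h2 h3 hn t ht
  have hR : 0 ≤ R := (norm_nonneg t).trans ht
  have hn' : (0 : ℝ) < n := by exact_mod_cast hn
  have hs : 0 < √(n : ℝ) := Real.sqrt_pos.2 hn'
  set W := (n : ℝ)⁻¹ • ∑ i ∈ Finset.range n,
      (if |e i| < k then (1 : ℝ) else 0) • InnerProductSpace.rankOne ℝ (v i) (v i) with hW
  have hsq2 : ∀ i, ((√(n : ℝ))⁻¹ * ⟪v i, t⟫_ℝ) ^ 2 = (n : ℝ)⁻¹ * ⟪v i, t⟫_ℝ ^ 2 := fun i => by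
    rw [mul_pow, inv_pow, Real.sq_sqrt hn'.le]
  have hWt : ⟪t, W t⟫_ℝ / 2 = ∑ i ∈ Finset.range n,
      (if |e i| < k then (1 : ℝ) else 0) * (((√(n : ℝ))⁻¹ * ⟪v i, t⟫_ℝ) ^ 2 / 2) := by
    simp only [hW, smul_apply, sum_apply,
      InnerProductSpace.rankOne_apply, inner_smul_right, inner_sum, Finset.mul_sum,
      Finset.sum_div, hsq2]
    refine Finset.sum_congr rfl fun i _ => ?_
    rw [real_inner_comm t (v i)]
    ring
  have hA : |localHuber k e v n t + ⟪huberScore k e v n, t⟫_ℝ - ⟪t, W t⟫_ℝ / 2| ≤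
      R ^ 2 / 2 * (δ / (R ^ 2 + 1)) := by
    rw [localHuber_add_score, hWt, ← Finset.sum_sub_distrib]
    refine (Finset.abs_sum_le_sum_abs _ _).trans ?_
    have hi : ∀ i ∈ Finset.range n, |huberRemainder k (e i) ((√(n : ℝ))⁻¹ * ⟪v i, t⟫_ℝ) -
        (if |e i| < k then (1 : ℝ) else 0) * (((√(n : ℝ))⁻¹ * ⟪v i, t⟫_ℝ) ^ 2 / 2)| ≤
        R ^ 2 / 2 * ((n : ℝ)⁻¹ *
          ((if |(|e i| - k)| ≤ ‖v i‖ / (M + 1) then (1 : ℝ) else 0) * ‖v i‖ ^ 2)) := by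
      intro i _
      refine (abs_huberRemainder_sub_le hk _ _).trans ?_
      have hvt : |⟪v i, t⟫_ℝ| ≤ R * ‖v i‖ :=
        (abs_real_inner_le_norm _ _).trans (by rw [mul_comm]; gcongr)
      rw [hsq2]
      have hvt2 : ⟪v i, t⟫_ℝ ^ 2 ≤ R ^ 2 * ‖v i‖ ^ 2 := by
        rw [← sq_abs, ← mul_pow]; gcongr
      by_cases hc : |(|e i| - k)| ≤ |(√(n : ℝ))⁻¹ * ⟪v i, t⟫_ℝ|
      · have hc' : |(|e i| - k)| ≤ ‖v i‖ / (M + 1) := by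
          refine hc.trans ?_
          rw [abs_mul, abs_of_pos (inv_pos.2 hs), inv_mul_le_iff₀ hs]
          refine hvt.trans ?_
          have : R * ‖v i‖ = (R * (M + 1)) * (‖v i‖ / (M + 1)) := by field_simp
          rw [this]
          gcongr
        rw [if_pos hc, if_pos hc', one_mul, one_mul]
        have : (n : ℝ)⁻¹ * ⟪v i, t⟫_ℝ ^ 2 ≤ (n : ℝ)⁻¹ * (R ^ 2 * ‖v i‖ ^ 2) := by gcongr
        linarith
      · rw [if_neg hc, zero_mul]
        split_ifs <;> positivity
    refine (Finset.sum_le_sum hi).trans ?_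
    rw [← Finset.mul_sum, ← Finset.mul_sum]
    rw [smul_eq_mul] at h1
    gcongr
  have hB : |⟪t, W t⟫_ℝ - ⟪t, V t⟫_ℝ| ≤ R ^ 2 * (δ / (R ^ 2 + 1)) := by
    rw [← inner_sub_right, ← sub_apply]
    calc |⟪t, (W - V) t⟫_ℝ| ≤ ‖t‖ * (‖W - V‖ * ‖t‖) :=
          (abs_real_inner_le_norm _ _).trans (by gcongr; exact (W - V).le_opNorm t)
      _ = ‖t‖ ^ 2 * ‖W - V‖ := by ring
      _ ≤ _ := by gcongr
  have hfin : R ^ 2 * (δ / (R ^ 2 + 1)) ≤ δ := by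
    rw [← mul_div_assoc, div_le_iff₀ (by positivity)]
    nlinarith
  rw [abs_le] at *
  constructor <;> linarith [hA.1, hA.2, hB.1, hB.2]

end LocalObjective

/-! ### Almost sure linearization of Huber estimators -/

section Linearization

variable {S : Type*} [MeasurableSpace S] {P : Measure S}
  {F : Type*} [NormedAddCommGroup F] [InnerProductSpace ℝ F] [FiniteDimensional ℝ F]
  [MeasurableSpace F] [BorelSpace F]

/-- The strong law of large numbers for a function of i.i.d. pairs. -/
theorem ae_tendsto_average_comp {E G : Type*} [MeasurableSpace E] [NormedAddCommGroup G]
    [NormedSpace ℝ G] [CompleteSpace G] [MeasurableSpace G] [BorelSpace G] {W : ℕ → S → E}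
    (hindep : iIndepFun W P) (hident : ∀ i, IdentDistrib (W i) (W 0) P P)
    {g : E → G} (hg : Measurable g) (hint : Integrable (fun ω => g (W 0 ω)) P) :
    ∀ᵐ ω ∂P, Tendsto (fun n : ℕ => (n : ℝ)⁻¹ • ∑ i ∈ Finset.range n, g (W i ω)) atTop
      (𝓝 (∫ ω, g (W 0 ω) ∂P)) :=
  strong_law_ae (fun i ω => g (W i ω)) hint
    (fun _ _ hij => (hindep.comp (fun _ => g) fun _ => hg).indepFun hij)
    fun i => (hident i).comp hg

/-- Off the null event `|e| = k` the window eventually excludes `|e|`, and `‖v‖ ^ 2` dominates. -/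
theorem tendsto_integral_indicator_near [IsProbabilityMeasure P]
    {E : Type*} [NormedAddCommGroup E] [MeasurableSpace E] [OpensMeasurableSpace E]
    {v : S → E} {e : S → ℝ} {k : ℝ} (hv : Measurable v)
    (he : Measurable e) (hL2 : MemLp v 2 P) (hatom : ∀ᵐ ω ∂P, |e ω| ≠ k) :
    Tendsto (fun M : ℕ => ∫ ω, (if |(|e ω| - k)| ≤ ‖v ω‖ / (M + 1) then (1 : ℝ) else 0) *
      ‖v ω‖ ^ 2 ∂P) atTop (𝓝 0) := by
  have hzero : ∫ _ : S, (0 : ℝ) ∂P = 0 := integral_zero S ℝ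
  rw [show 𝓝 (0 : ℝ) = 𝓝 (∫ _ : S, (0 : ℝ) ∂P) by rw [hzero]]
  refine tendsto_integral_of_dominated_convergence (fun ω => ‖v ω‖ ^ 2) (fun M => ?_)
    hL2.integrable_norm_pow' (fun M => ?_) ?_
  · refine Measurable.aestronglyMeasurable ?_
    refine Measurable.mul (Measurable.ite (measurableSet_le ?_ ?_) ?_ ?_) ?_ <;> fun_prop
  · refine Eventually.of_forall fun ω => ?_
    split_ifs
    · simp
    · simp
  · filter_upwards [hatom] with ω hω
    have hpos : 0 < |(|e ω| - k)| := abs_pos.2 (sub_ne_zero.2 hω)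
    have hlim : Tendsto (fun M : ℕ => ‖v ω‖ / ((M : ℝ) + 1)) atTop (𝓝 0) :=
      tendsto_const_nhds.div_atTop (tendsto_atTop_add_const_right _ _ tendsto_natCast_atTop_atTop)
    refine tendsto_const_nhds (x := (0 : ℝ)).congr' ?_
    filter_upwards [hlim.eventually (gt_mem_nhds hpos)] with M hM
    rw [if_neg (not_le.2 hM), zero_mul]

/-- Almost surely, as long as the normalized score stays bounded, minimizers of the local Huber
objective are asymptotically a linear function of the score. -/
theorem ae_eventually_norm_argmin_sub_le [IsProbabilityMeasure P]
    {v : ℕ → S → F} {e : ℕ → S → ℝ} {k : ℝ} (hk : 0 ≤ k)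
    (hv : Measurable (v 0)) (he : Measurable (e 0))
    (hindep : iIndepFun (fun i ω => (v i ω, e i ω)) P)
    (hident : ∀ i, IdentDistrib (fun ω => (v i ω, e i ω)) (fun ω => (v 0 ω, e 0 ω)) P P)
    (hL2 : MemLp (v 0) 2 P) (hve : IndepFun (v 0) (e 0) P) (hatom : ∀ᵐ ω ∂P, |e 0 ω| ≠ k)
    {q : ℝ} (hq : ∫ ω, (if |e 0 ω| < k then (1 : ℝ) else 0) ∂P = q)
    {V G : F →L[ℝ] F} (hV : ∀ s t, q * ∫ ω, ⟪s, v 0 ω⟫_ℝ * ⟪v 0 ω, t⟫_ℝ ∂P = ⟪s, V t⟫_ℝ)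
    {c : ℝ} (hc0 : 0 < c) (hc : ∀ t, c * ‖t‖ ^ 2 ≤ ⟪t, V t⟫_ℝ) (hG : ∀ t, V (G t) = t) :
    ∀ᵐ ω ∂P, ∀ R r : ℝ, 0 < r → ∀ᶠ n : ℕ in atTop, ∀ that : F,
      (∀ t, localHuber k (e · ω) (v · ω) n that ≤ localHuber k (e · ω) (v · ω) n t) →
      ‖huberScore k (e · ω) (v · ω) n‖ ≤ R →
      ‖that - G (huberScore k (e · ω) (v · ω) n)‖ ≤ r := by
  have hite : Measurable fun x : ℝ => if |x| < k then (1 : ℝ) else 0 :=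
    Measurable.ite (measurableSet_lt (by fun_prop) (by fun_prop)) measurable_const measurable_const
  have hvF : Continuous fun x : F => InnerProductSpace.rankOne ℝ x x :=
    (InnerProductSpace.rankOne ℝ).continuous.clm_apply continuous_id
  have hg1 : Measurable fun x : F × ℝ =>
      (if |x.2| < k then (1 : ℝ) else 0) • InnerProductSpace.rankOne ℝ x.1 x.1 := by
    refine Measurable.smul (f := fun x : F × ℝ => if |x.2| < k then (1 : ℝ) else 0)
      (g := fun x : F × ℝ => InnerProductSpace.rankOne ℝ x.1 x.1)
      (Measurable.ite (measurableSet_lt ?_ ?_) ?_ ?_)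
      (hvF.measurable.comp measurable_fst) <;> fun_prop
  have hint1 : Integrable (fun ω => (if |e 0 ω| < k then (1 : ℝ) else 0) •
      InnerProductSpace.rankOne ℝ (v 0 ω) (v 0 ω)) P := by
    refine Integrable.mono' (g := fun ω => ‖v 0 ω‖ ^ 2) hL2.integrable_norm_pow'
      (hg1.comp (hv.prodMk he)).aestronglyMeasurable (Eventually.of_forall fun ω => ?_)
    rw [norm_smul, InnerProductSpace.norm_rankOne, ← sq]
    split_ifs
    · simp
    · simp
  have hlim1 : ∫ ω, (if |e 0 ω| < k then (1 : ℝ) else 0) •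
      InnerProductSpace.rankOne ℝ (v 0 ω) (v 0 ω) ∂P = V := by
    ext t : 1
    refine ext_inner_left ℝ fun s => ?_
    rw [ContinuousLinearMap.integral_apply hint1, ← integral_inner (hint1.apply_continuousLinearMap t),
      ← hV, ← hq]
    have hin : Measurable fun x : F => ⟪s, x⟫_ℝ * ⟪x, t⟫_ℝ := by fun_prop
    have hind := hve.symm.comp hite hin
    refine Eq.trans ?_ (hind.integral_fun_mul_eq_mul_integral ?_ ?_)
    · refine integral_congr_ae (Eventually.of_forall fun ω => ?_)
      simp only [smul_apply, InnerProductSpace.rankOne_apply, inner_smul_right, Function.comp]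
      ring
    · exact (hite.comp he).aestronglyMeasurable
    · exact (hin.comp hv).aestronglyMeasurable
  have hsymm : ∀ s t, ⟪s, V t⟫_ℝ = ⟪t, V s⟫_ℝ := fun s t => by
    rw [← hV, ← hV]
    congr 1
    refine integral_congr_ae (Eventually.of_forall fun ω => ?_)
    simp only [real_inner_comm s, real_inner_comm t]
    ring
  have hg2 : ∀ M : ℕ, Measurable fun x : F × ℝ =>
      (if |(|x.2| - k)| ≤ ‖x.1‖ / (M + 1) then (1 : ℝ) else 0) * ‖x.1‖ ^ 2 := fun M => by
    refine Measurable.mul (Measurable.ite (measurableSet_le ?_ ?_) ?_ ?_) ?_ <;> fun_prop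
  have hint2 : ∀ M : ℕ, Integrable (fun ω =>
      (if |(|e 0 ω| - k)| ≤ ‖v 0 ω‖ / (M + 1) then (1 : ℝ) else 0) * ‖v 0 ω‖ ^ 2) P := fun M => by
    refine Integrable.mono' (g := fun ω => ‖v 0 ω‖ ^ 2) hL2.integrable_norm_pow'
      ((hg2 M).comp (hv.prodMk he)).aestronglyMeasurable (Eventually.of_forall fun ω => ?_)
    split_ifs
    · simp
    · simp
  have hℓ0 := tendsto_integral_indicator_near hv he hL2 hatom
  -- The windows are indexed by naturals, so one null set serves every `M`, and therefore every `R`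
  -- and `r`.
  filter_upwards [ae_tendsto_average_comp hindep hident hg1 hint1,
    ae_all_iff.2 fun M => ae_tendsto_average_comp hindep hident (hg2 M) (hint2 M)]
    with ω h1 h2 R r hr
  simp only [hlim1] at h1
  -- With this `δ`, `2 * δ = c * r ^ 2 / 4` is strictly below the required `c * r ^ 2 / 2`.
  have hδ : 0 < c * r ^ 2 / 8 := by positivity
  filter_upwards [eventually_localHuber_quadratic hk h1 h2 hℓ0 (‖G‖ * R + r) hδ]
    with n hn that hmin hU
  refine norm_argmin_sub_le (convexOn_localHuber hk _ _ n) hsymm hc (hG _) hmin hr hn ?_ ?_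
  · gcongr
    exact (G.le_opNorm _).trans (by gcongr)
  · linarith

end Linearization

/-! ### The multivariate central limit theorem -/

section CLT

variable {S : Type*} [MeasurableSpace S] {P : Measure S}
  {F : Type*} [NormedAddCommGroup F] [InnerProductSpace ℝ F] [FiniteDimensional ℝ F]
  [MeasurableSpace F] [BorelSpace F]

/-- The Cramér–Wold device: it reduces the multivariate limit theorem to the scalar one. -/
theorem charFun_map_eq_charFun_map_inner {Y : S → F} (hY : AEMeasurable Y P) (t : F) :
    charFun (P.map Y) t = charFun (P.map fun ω => ⟪Y ω, t⟫_ℝ) 1 := by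
  rw [charFun_apply, charFun_apply, integral_map hY (by fun_prop),
    integral_map (by fun_prop) (by fun_prop)]
  simp

/-- Characteristic functions of normalized sums of centred i.i.d. vectors converge to that of a
Gaussian. -/
theorem tendsto_charFun_inv_sqrt_smul_sum [IsProbabilityMeasure P] {W : ℕ → S → F}
    (hL2 : MemLp (W 0) 2 P)
    (hmean : ∫ ω, W 0 ω ∂P = 0) (hindep : iIndepFun W P)
    (hident : ∀ i, IdentDistrib (W i) (W 0) P P) (t : F) :
    Tendsto (fun n : ℕ => charFun (P.map fun ω => (√n)⁻¹ • ∑ i ∈ Finset.range n, W i ω) t) atTop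
      (𝓝 (Complex.exp (-((∫ ω, ⟪W 0 ω, t⟫_ℝ ^ 2 ∂P : ℝ) : ℂ) / 2))) := by
  have hW : ∀ i, AEMeasurable (W i) P := fun i => (hident i).aemeasurable_fst
  have hmt : Measurable fun x : F => ⟪x, t⟫_ℝ := by fun_prop
  have hL2t : MemLp (fun ω => ⟪W 0 ω, t⟫_ℝ) 2 P := hL2.inner_const t
  have hmeant : ∫ ω, ⟪W 0 ω, t⟫_ℝ ∂P = 0 := by
    simp_rw [real_inner_comm t]
    rw [integral_inner (hL2.integrable (by norm_num)), hmean, inner_zero_right]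
  have hvar : Var[fun ω => ⟪W 0 ω, t⟫_ℝ; P] = ∫ ω, ⟪W 0 ω, t⟫_ℝ ^ 2 ∂P :=
    variance_of_integral_eq_zero hL2t.aestronglyMeasurable.aemeasurable hmeant
  have hclt := tendstoInDistribution_inv_sqrt_mul_sum_sub (P := P)
    (X := fun i ω => ⟪W i ω, t⟫_ℝ) (Y := id)
    (P' := gaussianReal 0 Var[fun ω => ⟪W 0 ω, t⟫_ℝ; P].toNNReal) HasLaw.id hL2t
    (hindep.comp (fun _ x => ⟪x, t⟫_ℝ) fun _ => hmt) (fun i => (hident i).comp hmt)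
  have h1 := ProbabilityMeasure.tendsto_iff_tendsto_charFun.1 hclt.tendsto 1
  simp only [ProbabilityMeasure.coe_mk, Measure.map_id, charFun_gaussianReal] at h1
  convert h1 using 2 with n
  · rw [charFun_map_eq_charFun_map_inner (by fun_prop)]
    congr 2
    ext ω
    simp only [real_inner_smul_left, sum_inner, hmeant]
    ring
  · rw [hvar, Real.coe_toNNReal _ (by positivity)]
    congr 1
    push_cast
    ring

end CLT

/-! ### Convergence in measure from conditional almost sure convergence -/

/-- If `D n → 0` almost surely uniformly over bounded values of a tight sequence `U n`, then `D n`
tends to zero in measure. -/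
theorem tendstoInMeasure_zero_of_isTight {S : Type*} [MeasurableSpace S] {P : Measure S}
    [IsProbabilityMeasure P] {E F : Type*} [NormedAddCommGroup E] [MeasurableSpace E]
    [BorelSpace E] [SecondCountableTopology E] [NormedAddCommGroup F] [ProperSpace F]
    [MeasurableSpace F] [BorelSpace F] {D : ℕ → S → E}
    {U : ℕ → S → F} (hD : ∀ n, AEMeasurable (D n) P) (hU : ∀ n, AEMeasurable (U n) P)
    (htight : IsTightMeasureSet (Set.range fun n => P.map (U n)))
    (h : ∀ᵐ ω ∂P, ∀ R r : ℝ, 0 < r → ∀ᶠ n in atTop, ‖U n ω‖ ≤ R → ‖D n ω‖ ≤ r) :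
    TendstoInMeasure P D atTop 0 := by
  intro ε hε
  rw [ENNReal.tendsto_nhds_zero]
  intro δ hδ
  have hδ2 : 0 < δ / 2 := ENNReal.half_pos hδ.ne'
  have hsup := isTightMeasureSet_iff_tendsto_measure_norm_gt.1 htight
  obtain ⟨R, hR⟩ := ((ENNReal.tendsto_nhds_zero.1 hsup) (δ / 2) hδ2).exists
  have hR' : ∀ n, P {ω | R < ‖U n ω‖} ≤ δ / 2 := fun n => by
    refine le_trans ?_ hR
    refine le_trans (le_of_eq ?_) (le_iSup₂ (f := fun (μ : Measure F) _ => μ {x | R < ‖x‖})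
      (P.map (U n)) ⟨n, rfl⟩)
    rw [Measure.map_apply_of_aemeasurable (hU n) (measurableSet_lt (by fun_prop) (by fun_prop))]
    rfl
  -- Truncating `D n` where `U n` is large gives almost sure convergence; the discarded event has
  -- probability at most `δ / 2` by tightness.
  set f : ℕ → S → E := fun n ω => if ‖U n ω‖ ≤ R then D n ω else 0 with hf
  have hfm : TendstoInMeasure P f atTop 0 := by
    refine tendstoInMeasure_of_tendsto_ae (fun n => ?_) ?_
    · have hset : NullMeasurableSet {ω | ‖U n ω‖ ≤ R} P :=
        (hU n).nullMeasurable (measurableSet_le (by fun_prop) (by fun_prop) :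
          MeasurableSet {x : F | ‖x‖ ≤ R})
      have : f n = {ω | ‖U n ω‖ ≤ R}.indicator (D n) := by
        ext ω; simp [hf, Set.indicator_apply]
      rw [this]
      exact ((hD n).indicator₀ hset).aestronglyMeasurable
    · filter_upwards [h] with ω hω
      rw [Metric.tendsto_nhds]
      intro r hr
      filter_upwards [hω R (r / 2) (by positivity)] with n hn
      simp only [hf, Pi.zero_apply, dist_zero_right]
      split_ifs with hc
      · linarith [hn hc]
      · simpa using hr
  filter_upwards [ENNReal.tendsto_nhds_zero.1 (hfm ε hε) (δ / 2) hδ2] with n hn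
  calc P {ω | ε ≤ edist (D n ω) ((0 : S → E) ω)}
      ≤ P ({ω | ε ≤ edist (f n ω) ((0 : S → E) ω)} ∪ {ω | R < ‖U n ω‖}) := by
        refine measure_mono fun ω hω => ?_
        rcases le_or_gt ‖U n ω‖ R with hc | hc
        · left
          simpa [hf, hc] using hω
        · right; exact hc
    _ ≤ δ / 2 + δ / 2 := (measure_union_le _ _).trans (add_le_add hn (hR' n))
    _ = δ := ENNReal.add_halves δ

/-- A positive definite operator on a finite-dimensional space is coercive. -/
theorem exists_coercive_of_pos {F : Type*} [NormedAddCommGroup F] [InnerProductSpace ℝ F]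
    [FiniteDimensional ℝ F] {V : F →L[ℝ] F} (hV : ∀ t, t ≠ 0 → 0 < ⟪t, V t⟫_ℝ) :
    ∃ c : ℝ, 0 < c ∧ ∀ t, c * ‖t‖ ^ 2 ≤ ⟪t, V t⟫_ℝ := by
  rcases subsingleton_or_nontrivial F with hF | hF
  · exact ⟨1, one_pos, fun t => by simp [Subsingleton.elim t 0]⟩
  obtain ⟨x, hx, hmin⟩ := (isCompact_sphere (0 : F) 1).exists_isMinOn
    (NormedSpace.sphere_nonempty.2 zero_le_one)
    (f := fun t => ⟪t, V t⟫_ℝ) (by fun_prop)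
  have hx1 : ‖x‖ = 1 := by simpa using hx
  refine ⟨⟪x, V x⟫_ℝ, hV x (by rintro rfl; simp at hx1), fun t => ?_⟩
  rcases eq_or_ne t 0 with rfl | ht
  · simp
  have htn : ‖t‖ ≠ 0 := norm_ne_zero_iff.2 ht
  have h1 : (‖t‖⁻¹ • t) ∈ Metric.sphere (0 : F) 1 := by
    simp [norm_smul, htn]
  have h2 : ⟪x, V x⟫_ℝ ≤ ⟪‖t‖⁻¹ • t, V (‖t‖⁻¹ • t)⟫_ℝ := hmin h1
  rw [map_smul, real_inner_smul_left, real_inner_smul_right] at h2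
  have h3 : ‖t‖⁻¹ * (‖t‖⁻¹ * ⟪t, V t⟫_ℝ) = ⟪t, V t⟫_ℝ / ‖t‖ ^ 2 := by field_simp
  rw [h3, le_div_iff₀ (by positivity)] at h2
  exact h2

/-! ### Moments of the score terms -/

section Moments

variable {S : Type*} [MeasurableSpace S] {P : Measure S}
  {F : Type*} [NormedAddCommGroup F] [InnerProductSpace ℝ F] [FiniteDimensional ℝ F]
  [MeasurableSpace F] [BorelSpace F]

theorem memLp_huberPsi_smul {k : ℝ} (hk : 0 ≤ k) {e : S → ℝ} {v : S → F} (he : Measurable e)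
    (hv : Measurable v) (hL2 : MemLp v 2 P) : MemLp (fun ω => huberPsi k (e ω) • v ω) 2 P := by
  refine MemLp.of_le_mul (c := k) hL2
    (((continuous_huberPsi k).measurable.comp he).smul hv).aestronglyMeasurable
    (Eventually.of_forall fun ω => ?_)
  rw [norm_smul]
  gcongr
  exact abs_huberPsi_le hk _

theorem integral_huberPsi_smul_eq_zero [IsProbabilityMeasure P] {k : ℝ} (hk : 0 ≤ k) {e : S → ℝ}
    {v : S → F} (he : Measurable e) (hv : Measurable v) (hL2 : MemLp v 2 P) (hve : IndepFun v e P)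
    (hpsi : ∫ ω, huberPsi k (e ω) ∂P = 0) : ∫ ω, huberPsi k (e ω) • v ω ∂P = 0 := by
  refine ext_inner_left ℝ fun t => ?_
  rw [inner_zero_right, ← integral_inner ((memLp_huberPsi_smul hk he hv hL2).integrable
    (by norm_num))]
  simp_rw [real_inner_smul_right]
  have hψ := (continuous_huberPsi k).measurable
  have hin : Measurable fun x : F => ⟪t, x⟫_ℝ := by fun_prop
  have hind := hve.symm.comp hψ hin
  have := hind.integral_fun_mul_eq_mul_integral (hψ.comp he).aestronglyMeasurable
    (hin.comp hv).aestronglyMeasurable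
  simp only [Function.comp, hpsi, zero_mul] at this
  exact this

/-- Independence factors the score variance, making it proportional to the second-moment form that
also defines `V`. -/
theorem integral_inner_huberPsi_smul_sq {k : ℝ} {e : S → ℝ}
    {v : S → F} (he : Measurable e) (hv : Measurable v) (hve : IndepFun v e P) (t : F) :
    ∫ ω, ⟪huberPsi k (e ω) • v ω, t⟫_ℝ ^ 2 ∂P =
      (∫ ω, huberPsi k (e ω) ^ 2 ∂P) * ∫ ω, ⟪t, v ω⟫_ℝ * ⟪v ω, t⟫_ℝ ∂P := by
  have hψ : Measurable fun x => huberPsi k x ^ 2 :=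
    ((continuous_huberPsi k).pow 2).measurable
  have hin : Measurable fun x : F => ⟪t, x⟫_ℝ * ⟪x, t⟫_ℝ := by fun_prop
  have hind := hve.symm.comp hψ hin
  refine Eq.trans ?_ (hind.integral_fun_mul_eq_mul_integral (hψ.comp he).aestronglyMeasurable
    (hin.comp hv).aestronglyMeasurable)
  refine integral_congr_ae (Eventually.of_forall fun ω => ?_)
  simp only [Function.comp, real_inner_smul_left]
  rw [real_inner_comm (v ω) t]
  ring

end Moments

/-! ### Asymptotic normality of rescaled minimizers -/

section Asymptotics

variable {S : Type*} [MeasurableSpace S] {P : Measure S} [IsProbabilityMeasure P]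
  {F : Type*} [NormedAddCommGroup F] [InnerProductSpace ℝ F] [FiniteDimensional ℝ F]
  [MeasurableSpace F] [BorelSpace F]
  {E : Type*} [NormedAddCommGroup E] [InnerProductSpace ℝ E] [FiniteDimensional ℝ E]
  [MeasurableSpace E] [BorelSpace E]

/-- Any measurable linear image of the minimizers of the local Huber objective is asymptotically
normal. The minimizers themselves need not be measurable. -/
theorem tendstoInDistribution_argmin_localHuber {v : ℕ → S → F} {e : ℕ → S → ℝ} {k : ℝ}
    (hk : 0 ≤ k) (hv : Measurable (v 0)) (he : Measurable (e 0))
    (hindep : iIndepFun (fun i ω => (v i ω, e i ω)) P)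
    (hident : ∀ i, IdentDistrib (fun ω => (v i ω, e i ω)) (fun ω => (v 0 ω, e 0 ω)) P P)
    (hL2 : MemLp (v 0) 2 P) (hve : IndepFun (v 0) (e 0) P) (hatom : ∀ᵐ ω ∂P, |e 0 ω| ≠ k)
    (hpsi : ∫ ω, huberPsi k (e 0 ω) ∂P = 0)
    {q : ℝ} (hq : ∫ ω, (if |e 0 ω| < k then (1 : ℝ) else 0) ∂P = q) (hq0 : q ≠ 0)
    {V G : F →L[ℝ] F} (hV : ∀ s t, q * ∫ ω, ⟪s, v 0 ω⟫_ℝ * ⟪v 0 ω, t⟫_ℝ ∂P = ⟪s, V t⟫_ℝ)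
    (hpos : ∀ t, t ≠ 0 → 0 < ⟪t, V t⟫_ℝ) (hG : ∀ t, V (G t) = t)
    {that : ℕ → S → F} (hmin : ∀ᵐ ω ∂P, ∀ n, 0 < n → ∀ t,
      localHuber k (e · ω) (v · ω) n (that n ω) ≤ localHuber k (e · ω) (v · ω) n t)
    (L : F →L[ℝ] E) (hthat : ∀ n, AEMeasurable (fun ω => L (that n ω)) P)
    {ν : Measure E} [IsProbabilityMeasure ν]
    (hν : ∀ t, charFun ν t = Complex.exp
      (-((∫ ω, ⟪huberPsi k (e 0 ω) • L (G (v 0 ω)), t⟫_ℝ ^ 2 ∂P : ℝ) : ℂ) / 2)) :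
    TendstoInDistribution (fun n ω => L (that n ω)) atTop id (fun _ => P) ν := by
  obtain ⟨c, hc0, hc⟩ := exists_coercive_of_pos hpos
  have hlin := ae_eventually_norm_argmin_sub_le hk hv he hindep hident hL2 hve hatom hq hV hc0 hc hG
  have hψ := (continuous_huberPsi k).measurable
  have hg : Measurable fun x : F × ℝ => huberPsi k x.2 • x.1 :=
    (hψ.comp measurable_snd).smul measurable_fst
  have hLG : Measurable fun x : F × ℝ => huberPsi k x.2 • L (G x.1) :=
    (hψ.comp measurable_snd).smul ((L.comp G).measurable.comp measurable_fst)
  have hKindep := hindep.comp (fun _ => fun x : F × ℝ => huberPsi k x.2 • x.1) fun _ => hg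
  have hKident := fun i => (hident i).comp hg
  have hWindep := hindep.comp (fun _ => fun x : F × ℝ => huberPsi k x.2 • L (G x.1)) fun _ => hLG
  have hWident := fun i => (hident i).comp hLG
  have hKL2 := memLp_huberPsi_smul hk he hv hL2
  have hWL2 : MemLp (fun ω => huberPsi k (e 0 ω) • L (G (v 0 ω))) 2 P :=
    memLp_huberPsi_smul hk he ((L.comp G).measurable.comp hv) ((L.comp G).comp_memLp' hL2)
  have hKmean := integral_huberPsi_smul_eq_zero hk he hv hL2 hve hpsi
  have hWmean : ∫ ω, huberPsi k (e 0 ω) • L (G (v 0 ω)) ∂P = 0 :=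
    integral_huberPsi_smul_eq_zero hk he ((L.comp G).measurable.comp hv)
      ((L.comp G).comp_memLp' hL2) (hve.comp (L.comp G).measurable measurable_id) hpsi
  set U : ℕ → S → F := fun n ω => huberScore k (e · ω) (v · ω) n with hUdef
  have hUm : ∀ n, AEMeasurable (U n) P := fun n => by
    have : ∀ i, AEMeasurable (fun ω => huberPsi k (e i ω) • v i ω) P :=
      fun i => (hKident i).aemeasurable_fst
    simp only [hUdef, huberScore]
    fun_prop
  -- Expressing the limit through `V` makes its continuity in `t` evident, which is what the
  -- characteristic function criterion for tightness needs.
  have hUchar : ∀ t, Tendsto (fun n : ℕ => charFun (P.map (U n)) t) atTop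
      (𝓝 (Complex.exp (-(((∫ ω, huberPsi k (e 0 ω) ^ 2 ∂P) * (q⁻¹ * ⟪t, V t⟫_ℝ) : ℝ) : ℂ) / 2))) := by
    intro t
    have h : Tendsto (fun n : ℕ => charFun (P.map (U n)) t) atTop (𝓝 (Complex.exp
        (-((∫ ω, ⟪huberPsi k (e 0 ω) • v 0 ω, t⟫_ℝ ^ 2 ∂P : ℝ) : ℂ) / 2))) :=
      tendsto_charFun_inv_sqrt_smul_sum hKL2 hKmean hKindep hKident t
    have h2 := integral_inner_huberPsi_smul_sq (k := k) he hv hve t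
    have h3 : ∫ ω, ⟪t, v 0 ω⟫_ℝ * ⟪v 0 ω, t⟫_ℝ ∂P = q⁻¹ * ⟪t, V t⟫_ℝ := by
      rw [← hV, inv_mul_cancel_left₀ hq0]
    rwa [h2, h3] at h
  have : ∀ n, IsProbabilityMeasure (P.map (U n)) := fun n =>
    Measure.isProbabilityMeasure_map (hUm n)
  have htight : IsTightMeasureSet (Set.range fun n => P.map (U n)) :=
    isTightMeasureSet_of_tendsto_charFun (by fun_prop) hUchar
  set Y : ℕ → S → E := fun n ω => L (G (U n ω)) with hYdef
  have hYm : ∀ n, AEMeasurable (Y n) P := fun n =>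
    (L.comp G).measurable.comp_aemeasurable (hUm n)
  have hY : TendstoInDistribution Y atTop id (fun _ => P) ν := by
    refine ⟨hYm, aemeasurable_id, ?_⟩
    refine ProbabilityMeasure.tendsto_iff_tendsto_charFun.2 fun t => ?_
    simp only [ProbabilityMeasure.coe_mk, Measure.map_id, hν]
    have h := tendsto_charFun_inv_sqrt_smul_sum hWL2 hWmean hWindep hWident t
    convert h using 3 with n
    · congr 1
      ext ω
      simp [hYdef, hUdef, huberScore, map_sum, map_smul]
    · rfl
  -- Slutsky: it remains to show that the gap to the linearization `Y` vanishes in measure.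
  refine tendstoInDistribution_of_tendstoInMeasure_sub _ _ hY ?_ hthat
  refine tendstoInMeasure_zero_of_isTight (fun n => (hthat n).sub (hYm n)) hUm htight ?_
  filter_upwards [hlin, hmin] with ω h1 h2 R r hr
  have hr' : 0 < r / (‖L‖ + 1) := by positivity
  filter_upwards [h1 R _ hr', eventually_gt_atTop 0] with n hn hn0 hU
  have h3 := hn _ (h2 n hn0) hU
  calc ‖((fun n ω => L (that n ω)) - Y) n ω‖ = ‖L (that n ω - G (U n ω))‖ := by
        simp [hYdef]
    _ ≤ ‖L‖ * (r / (‖L‖ + 1)) := (L.le_opNorm _).trans (by gcongr)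
    _ ≤ (‖L‖ + 1) * (r / (‖L‖ + 1)) := by gcongr; linarith
    _ = r := by field_simp

end Asymptotics

/-! ### Matrices acting on Euclidean vectors -/

theorem inner_matApply_right {a b : ℕ} (M : Matrix (Fin a) (Fin b) ℝ)
    (s : EuclideanSpace ℝ (Fin a)) (w : EuclideanSpace ℝ (Fin b)) :
    ⟪s, matApply M w⟫_ℝ = ⟪matApply Mᵀ s, w⟫_ℝ := by
  simp only [matApply, EuclideanSpace.inner_eq_star_dotProduct, star_trivial]
  rw [Matrix.mulVec_transpose, dotProduct_comm, Matrix.dotProduct_mulVec, dotProduct_comm]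

theorem inner_matApply_left {a b : ℕ} (M : Matrix (Fin a) (Fin b) ℝ)
    (s : EuclideanSpace ℝ (Fin a)) (w : EuclideanSpace ℝ (Fin b)) :
    ⟪matApply M w, s⟫_ℝ = ⟪w, matApply Mᵀ s⟫_ℝ := by
  rw [real_inner_comm, inner_matApply_right, real_inner_comm]

theorem matApply_matApply {a b c : ℕ} (M : Matrix (Fin a) (Fin b) ℝ) (N : Matrix (Fin b) (Fin c) ℝ)
    (v : EuclideanSpace ℝ (Fin c)) : matApply M (matApply N v) = matApply (M * N) v := by
  simp [matApply]

theorem matApply_one {a : ℕ} (v : EuclideanSpace ℝ (Fin a)) :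
    matApply (1 : Matrix (Fin a) (Fin a) ℝ) v = v := by
  simp [matApply]

/-- `matApply` as a continuous linear map. -/
def matApplyL {a b : ℕ} (M : Matrix (Fin a) (Fin b) ℝ) :
    EuclideanSpace ℝ (Fin b) →L[ℝ] EuclideanSpace ℝ (Fin a) :=
  LinearMap.toContinuousLinearMap
    { toFun := matApply M
      map_add' := fun x y => by simp [matApply, Matrix.mulVec_add]
      map_smul' := fun c x => by simp [matApply, Matrix.mulVec_smul] }

@[simp]
theorem matApplyL_apply {a b : ℕ} (M : Matrix (Fin a) (Fin b) ℝ)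
    (v : EuclideanSpace ℝ (Fin b)) : matApplyL M v = matApply M v := rfl

theorem inner_matApply_pos {a : ℕ} {M : Matrix (Fin a) (Fin a) ℝ} (hM : M.PosDef)
    {v : EuclideanSpace ℝ (Fin a)} (hv : v ≠ 0) : 0 < ⟪v, matApply M v⟫_ℝ := by
  have h := (Matrix.posDef_iff_dotProduct_mulVec.1 hM).2 (x := v.ofLp) (by simpa using hv)
  simpa [matApply, EuclideanSpace.inner_eq_star_dotProduct, dotProduct_comm] using h

/-! ### Huber regression with an intercept -/

section Regression

variable {d : ℕ}

/-- The operator `(a, b) ↦ (a, T b)`. -/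
def interceptBlock {E : Type*} [NormedAddCommGroup E] [InnerProductSpace ℝ E] (T : E →L[ℝ] E) :
    WithLp 2 (ℝ × E) →L[ℝ] WithLp 2 (ℝ × E) :=
  ((WithLp.prodContinuousLinearEquiv 2 ℝ ℝ E).symm : ℝ × E →L[ℝ] WithLp 2 (ℝ × E)) ∘L
    ((ContinuousLinearMap.id ℝ ℝ).prodMap T) ∘L
      (WithLp.prodContinuousLinearEquiv 2 ℝ ℝ E : WithLp 2 (ℝ × E) →L[ℝ] ℝ × E)

@[simp]
theorem interceptBlock_apply {E : Type*} [NormedAddCommGroup E] [InnerProductSpace ℝ E]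
    (T : E →L[ℝ] E) (t : WithLp 2 (ℝ × E)) :
    interceptBlock T t = WithLp.toLp 2 (t.fst, T t.snd) := rfl

/-- In coordinates centred at `m`, the Huber objective is the local Huber objective up to a
constant. -/
theorem huberObjective_eq_localHuber (k : ℝ) {n : ℕ} {y ε : ℕ → ℝ}
    {z : ℕ → EuclideanSpace ℝ (Fin d)} {μ : ℝ} {β : EuclideanSpace ℝ (Fin d)}
    (hy : ∀ i, y i = μ + ⟪z i, β⟫_ℝ + ε i) (m : EuclideanSpace ℝ (Fin d))
    (t : WithLp 2 (ℝ × EuclideanSpace ℝ (Fin d))) :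
    huberObjective k n y z (μ + (√n)⁻¹ * (t.fst - ⟪m, t.snd⟫_ℝ)) (β + (√n)⁻¹ • t.snd) =
      localHuber k ε (fun i => WithLp.toLp 2 ((1 : ℝ), z i - m)) n t +
        ∑ i ∈ Finset.range n, huberLoss k (ε i) := by
  rw [localHuber, ← Finset.sum_add_distrib, huberObjective]
  refine Finset.sum_congr rfl fun i _ => ?_
  rw [sub_add_cancel]
  congr 1
  rw [hy, WithLp.prod_inner_apply]
  simp only [inner_add_right, inner_sub_left, real_inner_smul_right, WithLp.ofLp_fst,
    WithLp.ofLp_snd]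
  simp
  ring

/-- For `n > 0` the centred rescaling is invertible: each `t` corresponds to a competitor of the
fit, and the fit itself to the displayed point. -/
theorem localHuber_le_of_isHuberFit {k : ℝ} {n : ℕ} (hn : 0 < n) {y ε : ℕ → ℝ}
    {z : ℕ → EuclideanSpace ℝ (Fin d)} {μ : ℝ} {β : EuclideanSpace ℝ (Fin d)}
    (hy : ∀ i, y i = μ + ⟪z i, β⟫_ℝ + ε i) (m : EuclideanSpace ℝ (Fin d)) {a : ℝ}
    {b : EuclideanSpace ℝ (Fin d)} (hfit : IsHuberFit k n y z a b)
    (t : WithLp 2 (ℝ × EuclideanSpace ℝ (Fin d))) :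
    localHuber k ε (fun i => WithLp.toLp 2 ((1 : ℝ), z i - m)) n
        (√n • WithLp.toLp 2 (a - μ + ⟪m, b - β⟫_ℝ, b - β)) ≤
      localHuber k ε (fun i => WithLp.toLp 2 ((1 : ℝ), z i - m)) n t := by
  have hs : √(n : ℝ) ≠ 0 := (Real.sqrt_pos.2 (by exact_mod_cast hn)).ne'
  have h1 := hfit (μ + (√n)⁻¹ * (t.fst - ⟪m, t.snd⟫_ℝ)) (β + (√n)⁻¹ • t.snd)
  rw [huberObjective_eq_localHuber k hy m t] at h1
  have h2 := huberObjective_eq_localHuber k (n := n) hy m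
    (√n • WithLp.toLp 2 (a - μ + ⟪m, b - β⟫_ℝ, b - β))
  have ha : μ + (√n)⁻¹ * ((√n • WithLp.toLp 2 (a - μ + ⟪m, b - β⟫_ℝ, b - β)).fst -
      ⟪m, (√n • WithLp.toLp 2 (a - μ + ⟪m, b - β⟫_ℝ, b - β)).snd⟫_ℝ) = a := by
    change μ + (√n)⁻¹ * (√n * (a - μ + ⟪m, b - β⟫_ℝ) - ⟪m, √n • (b - β)⟫_ℝ) = a
    rw [real_inner_smul_right]
    field_simp
    ring
  have hb : β + (√n)⁻¹ • (√n • WithLp.toLp 2 (a - μ + ⟪m, b - β⟫_ℝ, b - β)).snd = b := by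
    simp [smul_smul, hs]
  rw [ha, hb] at h2
  linarith

variable {S : Type*} [MeasurableSpace S] {P : Measure S} [IsProbabilityMeasure P]

/-- Asymptotic normality of a linear image of the slope in Huber regression with random design and
independent errors. -/
theorem sqrtNAsympNormal_huberFit {p : ℕ} {k : ℝ} (hk : 0 < k)
    {Z : ℕ → S → EuclideanSpace ℝ (Fin d)} {ε y : ℕ → S → ℝ} {μ : ℝ}
    {β m : EuclideanSpace ℝ (Fin d)} {Sz : Matrix (Fin d) (Fin d) ℝ}
    (hZ : Measurable (Z 0)) (hε : Measurable (ε 0))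
    (hy : ∀ i ω, y i ω = μ + ⟪Z i ω, β⟫_ℝ + ε i ω)
    (hindep : iIndepFun (fun i ω => (Z i ω, ε i ω)) P)
    (hident : ∀ i, IdentDistrib (fun ω => (Z i ω, ε i ω)) (fun ω => (Z 0 ω, ε 0 ω)) P P)
    (hL2 : MemLp (Z 0) 2 P) (hmean : ∫ ω, Z 0 ω ∂P = m)
    (hcov : ∀ s t, ∫ ω, ⟪s, Z 0 ω - m⟫_ℝ * ⟪Z 0 ω - m, t⟫_ℝ ∂P = ⟪s, matApply Sz t⟫_ℝ)
    (hSz : Sz.PosDef) (hZε : IndepFun (Z 0) (ε 0) P) (hatom : ∀ᵐ ω ∂P, |ε 0 ω| ≠ k)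
    (hpsi : ∫ ω, huberPsi k (ε 0 ω) ∂P = 0)
    (hderiv : ∫ ω, deriv (huberPsi k) (ε 0 ω) ∂P ≠ 0)
    {muhat : ℕ → S → ℝ} {bhat : ℕ → S → EuclideanSpace ℝ (Fin d)}
    (hbhat : ∀ n, AEMeasurable (bhat n) P)
    (hfit : ∀ n, ∀ᵐ ω ∂P,
      IsHuberFit k n (fun i => y i ω) (fun i => Z i ω) (muhat n ω) (bhat n ω))
    (A : Matrix (Fin p) (Fin d) ℝ) :
    SqrtNAsympNormal P (fun n ω => matApply A (bhat n ω)) (matApply A β)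
      (huberFactor P k (ε 0) • (A * Sz⁻¹ * Aᵀ)) := by
  set q := ∫ ω, deriv (huberPsi k) (ε 0 ω) ∂P with hqdef
  have hq : ∫ ω, (if |ε 0 ω| < k then (1 : ℝ) else 0) ∂P = q :=
    integral_congr_ae (hatom.mono fun ω hω => (deriv_huberPsi hk hω).symm)
  -- `ψ'` is almost surely an indicator, so a nonzero expectation is positive.
  have hqpos : 0 < q := by
    refine lt_of_le_of_ne ?_ (Ne.symm hderiv)
    rw [← hq]
    exact integral_nonneg fun ω => by positivity
  have hdet : IsUnit Sz.det := hSz.det_pos.ne'.isUnit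
  have hfac : 0 ≤ huberFactor P k (ε 0) :=
    div_nonneg (integral_nonneg fun ω => sq_nonneg _) (sq_nonneg _)
  have hsymm : (Sz⁻¹)ᵀ = Sz⁻¹ := by simpa using hSz.inv.isHermitian.eq
  set v : ℕ → S → WithLp 2 (ℝ × EuclideanSpace ℝ (Fin d)) :=
    fun i ω => WithLp.toLp 2 ((1 : ℝ), Z i ω - m) with hvdef
  have hg : Measurable fun x : EuclideanSpace ℝ (Fin d) =>
      (WithLp.toLp 2 ((1 : ℝ), x - m) : WithLp 2 (ℝ × EuclideanSpace ℝ (Fin d))) :=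
    (WithLp.measurable_toLp 2 _).comp (by fun_prop)
  have hg2 : Measurable fun x : EuclideanSpace ℝ (Fin d) × ℝ =>
      ((WithLp.toLp 2 ((1 : ℝ), x.1 - m) : WithLp 2 (ℝ × EuclideanSpace ℝ (Fin d))), x.2) :=
    (hg.comp measurable_fst).prodMk measurable_snd
  have hw2 : MemLp (fun ω => Z 0 ω - m) 2 P := hL2.sub (memLp_const m)
  have hvL2 : MemLp (v 0) 2 P := MemLp.of_fst_of_snd_prodLp ⟨memLp_const 1, hw2⟩
  have hw0 : ∀ s, ∫ ω, ⟪s, Z 0 ω - m⟫_ℝ ∂P = 0 := fun s => by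
    rw [integral_inner (hw2.integrable (by norm_num)),
      integral_sub (hL2.integrable (by norm_num)) (integrable_const m), hmean]
    simp
  -- Centring at `m` removes the cross moments between intercept and slope (`hw0`), so `V` is block
  -- diagonal and inverts blockwise.
  set V := q • interceptBlock (matApplyL Sz) with hVdef
  set G := q⁻¹ • interceptBlock (matApplyL Sz⁻¹) with hGdef
  have hV : ∀ s t, q * ∫ ω, ⟪s, v 0 ω⟫_ℝ * ⟪v 0 ω, t⟫_ℝ ∂P = ⟪s, V t⟫_ℝ := by
    intro s t
    have h1 : ∀ ω, ⟪s, v 0 ω⟫_ℝ * ⟪v 0 ω, t⟫_ℝ = s.fst * t.fst + s.fst * ⟪t.snd, Z 0 ω - m⟫_ℝ +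
        t.fst * ⟪s.snd, Z 0 ω - m⟫_ℝ + ⟪s.snd, Z 0 ω - m⟫_ℝ * ⟪Z 0 ω - m, t.snd⟫_ℝ := fun ω => by
      rw [WithLp.prod_inner_apply, WithLp.prod_inner_apply, real_inner_comm (Z 0 ω - m) t.snd]
      simp [hvdef]
      ring
    have hi1 : ∀ s : EuclideanSpace ℝ (Fin d), MemLp (fun ω => ⟪s, Z 0 ω - m⟫_ℝ) 2 P :=
      fun s => hw2.const_inner s
    have hi2 : ∀ s : EuclideanSpace ℝ (Fin d), Integrable (fun ω => ⟪s, Z 0 ω - m⟫_ℝ) P :=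
      fun s => (hi1 s).integrable (by norm_num)
    have hi3 : Integrable (fun ω => ⟪s.snd, Z 0 ω - m⟫_ℝ * ⟪Z 0 ω - m, t.snd⟫_ℝ) P :=
      (hi1 s.snd).integrable_mul (hw2.inner_const t.snd)
    have hi4 : Integrable (fun ω => s.fst * t.fst + s.fst * ⟪t.snd, Z 0 ω - m⟫_ℝ) P :=
      (integrable_const _).add ((hi2 _).const_mul _)
    have hi5 : Integrable (fun ω => s.fst * t.fst + s.fst * ⟪t.snd, Z 0 ω - m⟫_ℝ +
        t.fst * ⟪s.snd, Z 0 ω - m⟫_ℝ) P := hi4.add ((hi2 _).const_mul _)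
    simp_rw [h1]
    rw [integral_add hi5 hi3, integral_add hi4 ((hi2 _).const_mul _),
      integral_add (integrable_const _) ((hi2 _).const_mul _), integral_const, integral_const_mul,
      integral_const_mul, hw0, hw0, hcov, hVdef, smul_apply, real_inner_smul_right,
      WithLp.prod_inner_apply]
    simp [mul_comm]
  have hpos : ∀ t, t ≠ 0 → 0 < ⟪t, V t⟫_ℝ := by
    intro t ht
    rw [hVdef, smul_apply, real_inner_smul_right, WithLp.prod_inner_apply]
    refine mul_pos hqpos ?_
    have h1 : ⟪t.fst, t.fst⟫_ℝ = t.fst ^ 2 := by simp [sq]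
    change 0 < ⟪t.fst, t.fst⟫_ℝ + ⟪t.snd, matApply Sz t.snd⟫_ℝ
    rw [h1]
    rcases eq_or_ne t.snd 0 with h2 | h2
    · have h3 : t.fst ≠ 0 := fun h3 => ht (by
        apply WithLp.ofLp_injective 2
        exact Prod.ext h3 h2)
      rw [h2, inner_zero_left, add_zero]
      positivity
    · have := inner_matApply_pos hSz h2
      positivity
  have hG : ∀ t, V (G t) = t := by
    intro t
    rw [hVdef, hGdef, smul_apply, smul_apply, map_smul, smul_smul, mul_inv_cancel₀ hqpos.ne',
      one_smul]
    have h1 : matApply Sz (matApply Sz⁻¹ t.snd) = t.snd := by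
      rw [matApply_matApply, Matrix.mul_nonsing_inv _ hdet, matApply_one]
    change WithLp.toLp 2 (t.fst, matApply Sz (matApply Sz⁻¹ t.snd)) = t
    rw [h1]
    rfl
  set that : ℕ → S → WithLp 2 (ℝ × EuclideanSpace ℝ (Fin d)) := fun n ω =>
    √n • WithLp.toLp 2 (muhat n ω - μ + ⟪m, bhat n ω - β⟫_ℝ, bhat n ω - β) with hthat
  have hmin : ∀ᵐ ω ∂P, ∀ n, 0 < n → ∀ t,
      localHuber k (ε · ω) (v · ω) n (that n ω) ≤ localHuber k (ε · ω) (v · ω) n t := by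
    filter_upwards [ae_all_iff.2 hfit] with ω hω n hn t
    exact localHuber_le_of_isHuberFit hn (fun i => hy i ω) m (hω n) t
  set L := matApplyL A ∘L WithLp.sndL 2 ℝ ℝ (EuclideanSpace ℝ (Fin d)) with hL
  have hLthat : (fun n ω => L (that n ω)) =
      fun (n : ℕ) ω => √(n : ℝ) • (matApply A (bhat n ω) - matApply A β) := by
    ext1 n
    ext1 ω
    rw [← matApplyL_apply A (bhat n ω), ← matApplyL_apply A β, ← map_sub, ← map_smul]
    rfl
  -- `L` discards the intercept coordinate, so no measurability of `muhat` is needed.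
  have hLmeas : ∀ n, AEMeasurable (fun ω => L (that n ω)) P := fun n => by
    have : (fun ω => L (that n ω)) = fun ω => √(n : ℝ) • (matApplyL A (bhat n ω) - matApplyL A β) :=
      congrFun hLthat n
    rw [this]
    have := hbhat n
    fun_prop
  have hLG : ∀ ω, L (G (v 0 ω)) = q⁻¹ • matApply (A * Sz⁻¹) (Z 0 ω - m) := fun ω => by
    rw [hGdef, smul_apply, map_smul, ← matApply_matApply]
    rfl
  have hpsd : (huberFactor P k (ε 0) • (A * Sz⁻¹ * Aᵀ)).PosSemidef := by
    have := (hSz.inv.posSemidef.mul_mul_conjTranspose_same A).smul hfac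
    simpa using this
  have hind : IndepFun (v 0) (ε 0) P := hZε.comp hg measurable_id
  have hν : ∀ t, charFun (multivariateGaussian 0 (huberFactor P k (ε 0) • (A * Sz⁻¹ * Aᵀ))) t =
      Complex.exp (-((∫ ω, ⟪huberPsi k (ε 0 ω) • L (G (v 0 ω)), t⟫_ℝ ^ 2 ∂P : ℝ) : ℂ) / 2) := by
    intro t
    have h0 : ∫ ω, ⟪huberPsi k (ε 0 ω) • L (G (v 0 ω)), t⟫_ℝ ^ 2 ∂P =
        (∫ ω, huberPsi k (ε 0 ω) ^ 2 ∂P) * ∫ ω, ⟪t, L (G (v 0 ω))⟫_ℝ * ⟪L (G (v 0 ω)), t⟫_ℝ ∂P :=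
      integral_inner_huberPsi_smul_sq hε ((L.comp G).measurable.comp (hg.comp hZ))
        (hind.comp (L.comp G).measurable measurable_id) t
    have h1 : ∀ ω, ⟪t, L (G (v 0 ω))⟫_ℝ * ⟪L (G (v 0 ω)), t⟫_ℝ =
        (q ^ 2)⁻¹ * (⟪matApply (A * Sz⁻¹)ᵀ t, Z 0 ω - m⟫_ℝ *
          ⟪Z 0 ω - m, matApply (A * Sz⁻¹)ᵀ t⟫_ℝ) := fun ω => by
      rw [hLG, real_inner_smul_left, real_inner_smul_right, inner_matApply_left,
        inner_matApply_right _ t]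
      ring
    have h2 : ∫ ω, ⟪t, L (G (v 0 ω))⟫_ℝ * ⟪L (G (v 0 ω)), t⟫_ℝ ∂P =
        (q ^ 2)⁻¹ * ⟪t, matApply (A * Sz⁻¹ * Aᵀ) t⟫_ℝ := by
      simp_rw [h1]
      rw [integral_const_mul, hcov, ← inner_matApply_right, matApply_matApply, matApply_matApply,
        Matrix.transpose_mul, hsymm]
      have h4 : A * Sz⁻¹ * Sz * (Sz⁻¹ * Aᵀ) = A * Sz⁻¹ * Aᵀ := by
        rw [Matrix.mul_assoc A, Matrix.nonsing_inv_mul _ hdet, Matrix.mul_one, Matrix.mul_assoc]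
      rw [h4]
    have h3 : t.ofLp ⬝ᵥ (huberFactor P k (ε 0) • (A * Sz⁻¹ * Aᵀ)) *ᵥ t.ofLp =
        (∫ ω, huberPsi k (ε 0 ω) ^ 2 ∂P) * ((q ^ 2)⁻¹ * ⟪t, matApply (A * Sz⁻¹ * Aᵀ) t⟫_ℝ) := by
      rw [Matrix.smul_mulVec, dotProduct_smul, smul_eq_mul, huberFactor, ← hqdef, matApply,
        EuclideanSpace.inner_eq_star_dotProduct, star_trivial, dotProduct_comm]
      ring
    rw [charFun_multivariateGaussian hpsd, h3, inner_zero_right, h0, h2]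
    congr 1
    push_cast
    ring
  have h := tendstoInDistribution_argmin_localHuber hk.le (hg.comp hZ) hε
    (hindep.comp (fun _ => _) fun _ => hg2) (fun i => (hident i).comp hg2) hvL2 hind hatom hpsi hq
    hqpos.ne' hV hpos hG hmin L hLmeas hν
  rw [hLthat] at h
  exact h

end Regression

/-! ### Orthonormal bases of a subspace and of its orthogonal complement -/

section Envelope

variable {p u w : ℕ}

theorem matApply_mem_colSpan (M : Matrix (Fin p) (Fin u) ℝ) (a : EuclideanSpace ℝ (Fin u)) :
    matApply M a ∈ colSpan M := by
  have h : matApply M a = ∑ j, a j • (WithLp.toLp 2 (fun i => M i j) : EuclideanSpace ℝ (Fin p)) := by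
    ext i
    simp [matApply, Matrix.mulVec, dotProduct, mul_comm]
  rw [h]
  exact Submodule.sum_mem _ fun j _ => Submodule.smul_mem _ _ (Submodule.subset_span ⟨j, rfl⟩)

theorem exists_matApply_of_mem_colSpan {M : Matrix (Fin p) (Fin u) ℝ}
    {x : EuclideanSpace ℝ (Fin p)} (hx : x ∈ colSpan M) : ∃ a, matApply M a = x := by
  have h : colSpan M ≤ LinearMap.range (matApplyL M).toLinearMap := by
    refine Submodule.span_le.2 ?_
    rintro _ ⟨j, rfl⟩
    refine ⟨EuclideanSpace.single j 1, ?_⟩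
    ext i
    simp [matApply]
  exact h hx

theorem matrix_ext_of_matApply {M N : Matrix (Fin p) (Fin u) ℝ}
    (h : ∀ v, matApply M v = matApply N v) : M = N := by
  refine Matrix.ext_of_mulVec_single fun j => ?_
  have := congrArg WithLp.ofLp (h (EuclideanSpace.single j 1))
  simpa [matApply] using this

theorem mulVec_injective_of_mul_eq_one {M : Matrix (Fin p) (Fin u) ℝ}
    {N : Matrix (Fin u) (Fin p) ℝ} (h : N * M = 1) : Function.Injective M.mulVec := fun x y hxy => by
  have := congrArg N.mulVec hxy
  simpa [h] using this

theorem transpose_mul_eq_zero_of_colSpan_orthogonal {Γ : Matrix (Fin p) (Fin u) ℝ}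
    {Γ₀ : Matrix (Fin p) (Fin w) ℝ} {R : Submodule ℝ (EuclideanSpace ℝ (Fin p))}
    (h : colSpan Γ = R) (h₀ : colSpan Γ₀ = Rᗮ) : Γᵀ * Γ₀ = 0 := by
  refine matrix_ext_of_matApply fun v => ext_inner_left ℝ fun s => ?_
  rw [← matApply_matApply, ← inner_matApply_left]
  have h1 : matApply Γ s ∈ R := h ▸ matApply_mem_colSpan Γ s
  have h2 : matApply Γ₀ v ∈ Rᗮ := h₀ ▸ matApply_mem_colSpan Γ₀ v
  rw [Submodule.inner_right_of_mem_orthogonal h1 h2]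
  simp [matApply]

/-- Every vector splits as `Γ a + Γ₀ b`; on each summand one projection is the identity and the
other vanishes. -/
theorem mul_transpose_add_mul_transpose_eq_one {Γ : Matrix (Fin p) (Fin u) ℝ}
    {Γ₀ : Matrix (Fin p) (Fin w) ℝ} {R : Submodule ℝ (EuclideanSpace ℝ (Fin p))}
    (h : colSpan Γ = R) (h₀ : colSpan Γ₀ = Rᗮ) (hΓ : Γᵀ * Γ = 1) (hΓ₀ : Γ₀ᵀ * Γ₀ = 1) :
    Γ * Γᵀ + Γ₀ * Γ₀ᵀ = 1 := by
  have h1 := transpose_mul_eq_zero_of_colSpan_orthogonal h h₀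
  have h2 : Γ₀ᵀ * Γ = 0 := by
    rw [← Matrix.transpose_transpose Γ, ← Matrix.transpose_mul, h1, Matrix.transpose_zero]
  refine matrix_ext_of_matApply fun x => ?_
  obtain ⟨y, hy, z, hz, rfl⟩ := R.exists_add_mem_mem_orthogonal x
  obtain ⟨a, rfl⟩ := exists_matApply_of_mem_colSpan (h.symm ▸ hy)
  obtain ⟨b, rfl⟩ := exists_matApply_of_mem_colSpan (h₀.symm ▸ hz)
  rw [matApply_one, ← matApplyL_apply (Γ * Γᵀ + Γ₀ * Γ₀ᵀ), map_add]
  simp only [matApplyL_apply, matApply_matApply, Matrix.add_mul, Matrix.mul_assoc, hΓ, hΓ₀, h1, h2,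
    Matrix.mul_zero, Matrix.mul_one, add_zero, zero_add]

end Envelope

/-! ### Second moments as a bilinear form. -/

section Covariance

variable {S : Type*} [MeasurableSpace S] {P : Measure S} [IsProbabilityMeasure P]

/-- The covariance matrix represents the covariance form. -/
theorem integral_inner_sub_mean_mul {p : ℕ} {X : S → EuclideanSpace ℝ (Fin p)} (hL2 : MemLp X 2 P)
    {m : EuclideanSpace ℝ (Fin p)} (hmean : ∫ ω, X ω ∂P = m) {Sx : Matrix (Fin p) (Fin p) ℝ}
    (hcov : ∀ a b, cov[fun ω => X ω a, fun ω => X ω b; P] = Sx a b)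
    (s t : EuclideanSpace ℝ (Fin p)) :
    ∫ ω, ⟪s, X ω - m⟫_ℝ * ⟪X ω - m, t⟫_ℝ ∂P = ⟪s, matApply Sx t⟫_ℝ := by
  have hm : ∀ a, ∫ ω, X ω a ∂P = m a := fun a => by
    rw [← hmean]
    exact (EuclideanSpace.proj (𝕜 := ℝ) a : EuclideanSpace ℝ (Fin p) →L[ℝ] ℝ).integral_comp_comm
      (hL2.integrable (by norm_num))
  have hL2a : ∀ a, MemLp (fun ω => X ω a - m a) 2 P := fun a =>
    ((EuclideanSpace.proj (𝕜 := ℝ) a : EuclideanSpace ℝ (Fin p) →L[ℝ] ℝ).comp_memLp' hL2).sub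
      (memLp_const (m a))
  have hab : ∀ a b, ∫ ω, (X ω a - m a) * (X ω b - m b) ∂P = Sx a b := fun a b => by
    rw [← hcov, covariance, hm, hm]
  have hint : ∀ a b, Integrable (fun ω => s a * t b * ((X ω a - m a) * (X ω b - m b))) P :=
    fun a b => ((hL2a a).integrable_mul (hL2a b)).const_mul _
  have hexp : ∀ ω, ⟪s, X ω - m⟫_ℝ * ⟪X ω - m, t⟫_ℝ =
      ∑ a, ∑ b, s a * t b * ((X ω a - m a) * (X ω b - m b)) := fun ω => by
    simp only [PiLp.inner_apply, Finset.sum_mul_sum]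
    refine Finset.sum_congr rfl fun a _ => Finset.sum_congr rfl fun b _ => ?_
    simp
    ring
  simp_rw [hexp]
  rw [integral_finsetSum _ fun a _ => integrable_finsetSum _ fun b _ => hint a b]
  simp_rw [integral_finsetSum _ fun b _ => hint _ b, integral_const_mul, hab]
  simp only [PiLp.inner_apply, matApply, Matrix.mulVec, dotProduct]
  refine Finset.sum_congr rfl fun a _ => ?_
  simp only [RCLike.inner_apply, conj_trivial, Finset.sum_mul]
  refine Finset.sum_congr rfl fun b _ => ?_
  ring

end Covariance

end

/-! ### Comparison of the enveloped and the usual Huber estimators. -/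

theorem proposition2 {S : Type*} [MeasurableSpace S] (P : Measure S) [IsProbabilityMeasure P]
    {p u : ℕ} (k : ℝ) (hk : 0 < k)
    (X : ℕ → S → EuclideanSpace ℝ (Fin p)) (ε y : ℕ → S → ℝ)
    (μ : ℝ) (β μx : EuclideanSpace ℝ (Fin p)) (Sx : Matrix (Fin p) (Fin p) ℝ)
    (Γ : Matrix (Fin p) (Fin u) ℝ) (Γ₀ : Matrix (Fin p) (Fin (p - u)) ℝ)
    (η : EuclideanSpace ℝ (Fin u)) (Ω : Matrix (Fin u) (Fin u) ℝ)
    (Ω₀ : Matrix (Fin (p - u)) (Fin (p - u)) ℝ)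
    (hmodel : EnvelopedHuberModel P k X ε y μ β μx Sx Γ Γ₀ η Ω Ω₀)
    (hindep : IndepFun (X 0) (ε 0) P)
    -- `ψ'(ε)` is almost surely defined, and its expectation is nonzero
    (hatom : ∀ᵐ ω ∂P, |ε 0 ω| ≠ k)
    (hderiv : ∫ ω, deriv (huberPsi k) (ε 0 ω) ∂P ≠ 0)
    -- the Huber regression of `y` on `Γᵀ x`
    (muhat : ℕ → S → ℝ) (etahat : ℕ → S → EuclideanSpace ℝ (Fin u))
    (hetahat : ∀ n, AEMeasurable (etahat n) P)
    (hfit : ∀ n, ∀ᵐ ω ∂P,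
      IsHuberFit k n (fun i => y i ω) (fun i => matApply Γᵀ (X i ω)) (muhat n ω) (etahat n ω)) :
    Ω.PosDef ∧
    SqrtNAsympNormal P (fun n ω => matApply Γ (etahat n ω)) β
      (huberFactor P k (ε 0) • (Γ * Ω⁻¹ * Γᵀ)) ∧
    -- the Huber regression of `y` on `x`
    (∀ (muhat_h : ℕ → S → ℝ) (betahat_h : ℕ → S → EuclideanSpace ℝ (Fin p)),
      (∀ n, AEMeasurable (betahat_h n) P) →
      (∀ n, ∀ᵐ ω ∂P,
        IsHuberFit k n (fun i => y i ω) (fun i => X i ω) (muhat_h n ω) (betahat_h n ω)) →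
      SqrtNAsympNormal P betahat_h β (huberFactor P k (ε 0) • Sx⁻¹)) ∧
    (huberFactor P k (ε 0) • Sx⁻¹ - huberFactor P k (ε 0) • (Γ * Ω⁻¹ * Γᵀ)).PosSemidef ∧
    (u < p → ∫ ω, huberPsi k (ε 0 ω) ^ 2 ∂P ≠ 0 →
      huberFactor P k (ε 0) • (Γ * Ω⁻¹ * Γᵀ) ≠ huberFactor P k (ε 0) • Sx⁻¹) := by
  have hX := hmodel.measurable_X 0
  have hε := hmodel.measurable_ε 0
  have hΓ := hmodel.semiorthogonal
  have hΓ₀ := hmodel.semiorthogonal₀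
  have hcross := transpose_mul_eq_zero_of_colSpan_orthogonal hmodel.span_eq hmodel.span_eq₀
  have hcross' : Γ₀ᵀ * Γ = 0 := by
    rw [← Matrix.transpose_transpose Γ, ← Matrix.transpose_mul, hcross, Matrix.transpose_zero]
  have hcomplete := mul_transpose_add_mul_transpose_eq_one hmodel.span_eq hmodel.span_eq₀ hΓ hΓ₀
  have hSΓ : Sx * Γ = Γ * Ω := by
    rw [hmodel.cov_decomp, Matrix.add_mul, Matrix.mul_assoc, hΓ, Matrix.mul_assoc _ Γ₀ᵀ, hcross']
    simp
  have hSΓ₀ : Sx * Γ₀ = Γ₀ * Ω₀ := by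
    rw [hmodel.cov_decomp, Matrix.add_mul, Matrix.mul_assoc _ Γᵀ, hcross, Matrix.mul_assoc _ Γ₀ᵀ,
      hΓ₀]
    simp
  have hΩeq : Γᵀ * Sx * Γ = Ω := by
    rw [Matrix.mul_assoc, hSΓ, ← Matrix.mul_assoc, hΓ, Matrix.one_mul]
  have hΩ₀eq : Γ₀ᵀ * Sx * Γ₀ = Ω₀ := by
    rw [Matrix.mul_assoc, hSΓ₀, ← Matrix.mul_assoc, hΓ₀, Matrix.one_mul]
  -- `Ω` is the compression of `Sx` by the injective matrix `Γ`, so it inherits definiteness;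
  -- likewise `Ω₀`.
  have hΩ : Ω.PosDef := by
    have h := hmodel.posDef_cov.conjTranspose_mul_mul_same (B := Γ)
      (mulVec_injective_of_mul_eq_one hΓ)
    simpa [hΩeq] using h
  have hΩ₀ : Ω₀.PosDef := by
    have h := hmodel.posDef_cov.conjTranspose_mul_mul_same (B := Γ₀)
      (mulVec_injective_of_mul_eq_one hΓ₀)
    simpa [hΩ₀eq] using h
  -- `Sx` acts as `Ω` and `Ω₀` on the two ranges, so inverting each block produces a right inverse
  -- by completeness of the two bases.
  have hinv : Sx⁻¹ = Γ * Ω⁻¹ * Γᵀ + Γ₀ * Ω₀⁻¹ * Γ₀ᵀ := by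
    refine Matrix.inv_eq_right_inv ?_
    rw [Matrix.mul_add, ← Matrix.mul_assoc, ← Matrix.mul_assoc, hSΓ, Matrix.mul_assoc Γ,
      Matrix.mul_nonsing_inv _ hΩ.det_pos.ne'.isUnit, ← Matrix.mul_assoc, ← Matrix.mul_assoc, hSΓ₀,
      Matrix.mul_assoc Γ₀, Matrix.mul_nonsing_inv _ hΩ₀.det_pos.ne'.isUnit, Matrix.mul_one,
      Matrix.mul_one, hcomplete]
  have hfac : 0 ≤ huberFactor P k (ε 0) :=
    div_nonneg (integral_nonneg fun ω => sq_nonneg _) (sq_nonneg _)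
  have hpsi : ∫ ω, huberPsi k (ε 0 ω) ∂P = 0 := by
    rw [← integral_condExp hX.comap_le, integral_congr_ae hmodel.condExp_psi]
    simp
  have hcovX := integral_inner_sub_mean_mul hmodel.memLp_two hmodel.mean_eq hmodel.cov_eq
  refine ⟨hΩ, ?_, ?_, ?_, ?_⟩
  · have hg : Measurable fun x : EuclideanSpace ℝ (Fin p) × ℝ => (matApply Γᵀ x.1, x.2) :=
      ((matApplyL Γᵀ).measurable.comp measurable_fst).prodMk measurable_snd
    have hmean : ∫ ω, matApply Γᵀ (X 0 ω) ∂P = matApply Γᵀ μx := by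
      rw [← hmodel.mean_eq]
      exact (matApplyL Γᵀ).integral_comp_comm (hmodel.memLp_two.integrable (by norm_num))
    -- Since `⟪x, Γ η⟫ = ⟪Γᵀ x, η⟫`, the reduced regression is correctly specified with the same
    -- errors; its slope is then mapped back by `A = Γ`.
    have h := sqrtNAsympNormal_huberFit (P := P) hk (Z := fun i ω => matApply Γᵀ (X i ω))
      (μ := μ) (β := η) (m := matApply Γᵀ μx) (Sz := Ω) (y := y)
      ((matApplyL Γᵀ).measurable.comp hX) hε
      (fun i ω => by
        rw [hmodel.response, hmodel.slope_eq, inner_matApply_right])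
      (hmodel.indep.comp (fun _ => _) fun _ => hg) (fun i => (hmodel.ident i).comp hg)
      ((matApplyL Γᵀ).comp_memLp' hmodel.memLp_two) hmean
      (fun s t => by
        have hsub : ∀ ω, matApply Γᵀ (X 0 ω) - matApply Γᵀ μx = matApply Γᵀ (X 0 ω - μx) :=
          fun ω => ((matApplyL Γᵀ).map_sub _ _).symm
        simp_rw [hsub, fun ω => inner_matApply_right Γᵀ s (X 0 ω - μx),
          fun ω => inner_matApply_left Γᵀ t (X 0 ω - μx), Matrix.transpose_transpose]
        rw [hcovX, inner_matApply_left, matApply_matApply, matApply_matApply, hΩeq])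
      hΩ (hindep.comp (matApplyL Γᵀ).measurable measurable_id) hatom hpsi hderiv hetahat hfit Γ
    rwa [← hmodel.slope_eq] at h
  · intro muhat_h betahat_h hmeas hfit_h
    have h := sqrtNAsympNormal_huberFit (P := P) hk hX hε hmodel.response hmodel.indep hmodel.ident
      hmodel.memLp_two hmodel.mean_eq hcovX hmodel.posDef_cov hindep hatom hpsi hderiv hmeas hfit_h
      (1 : Matrix (Fin p) (Fin p) ℝ)
    simpa [matApply_one] using h
  · rw [hinv, ← smul_sub, add_sub_cancel_left]
    have := (hΩ₀.inv.posSemidef.mul_mul_conjTranspose_same Γ₀).smul hfac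
    simpa using this
  · intro hup hne heq
    have hfac0 : huberFactor P k (ε 0) ≠ 0 := div_ne_zero hne (pow_ne_zero 2 hderiv)
    have h1 : Γ₀ * Ω₀⁻¹ * Γ₀ᵀ = 0 := by
      have h := smul_right_injective _ hfac0 heq
      rw [hinv] at h
      exact left_eq_add.1 h
    -- Compressing by `Γ₀` recovers the block; a zero inverse is impossible because `u < p` makes
    -- its index type nonempty.
    have h2 : Ω₀⁻¹ = 0 := by
      have h : Γ₀ᵀ * (Γ₀ * Ω₀⁻¹ * Γ₀ᵀ) * Γ₀ = Ω₀⁻¹ := by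
        rw [← Matrix.mul_assoc, ← Matrix.mul_assoc, hΓ₀, Matrix.mul_assoc, hΓ₀, Matrix.one_mul,
          Matrix.mul_one]
      rw [← h, h1, Matrix.mul_zero, Matrix.zero_mul]
    have h3 := Matrix.mul_nonsing_inv _ hΩ₀.det_pos.ne'.isUnit
    rw [h2, Matrix.mul_zero] at h3
    have := congrFun (congrFun h3 ⟨0, by omega⟩) ⟨0, by omega⟩
    simp at this
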